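/- For every $n\in\mathbb N$ let $p_{1:n},\dots,p_{n:n}\in[0,1]$ and let $B_{1:n},\dots,B_{n:n}$ be mutually independent Bernoulli random variables on a common probability space with $\mathbb P[B_{k:n}=1]=p_{k:n}=1-\mathbb P[B_{k:n}=0]$. Put $S_n=\sum_{k=1}^n B_{k:n}$, $M_n=\frac1n\sum_{k=1}^n\delta_{p_{k:n}}$, $\underline r_n=\#\{1\le k\le n: p_{k:n}=1\}$ and $\overline r_n=n-\#\{1\le k\le n: p_{k:n}=0\}$. We put $\log 0=-\infty$. Assume that there are $0\le \underline m<\overline m\le 1$ and a function $g:(\underline m,\overline m)\to(-\infty,0]$ such that $$\lim_{n\to\infty}\frac1n\log\mathbb P[S_n=\lfloor\alpha n\rfloor]=\begin{cases} g(\alpha), & \alpha\in(\underline m,\overline m),\\ -\infty, & \alpha\in[0,\underline m)\cup(\overline m,1].\end{cases}$$ Then $M_n$ converges weakly, as $n\to\infty$, to a probability measure $M_\infty$ on $[0,1]$ with $M_\infty(\{1\})=\underline m$ and $M_\infty(\{0\})=1-\overline m$. Moreover, with $$\Psi(t)=\int_{[0,1]}\log(1-y+yt)\,M_\infty(\mathrm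 dy),\qquad \Phi(t)=t\int_{[0,1]}\frac{y\,M_\infty(\mathrm dy)}{1-y+yt},\qquad t>0,$$ the following hold. In (b), (c), (g) and (h), $\varepsilon>0$ is arbitrary, $k$ ranges over nonnegative integers, and a statement about a supremum or an infimum over an empty set is void. (a) $g$ is infinitely differentiable and strictly concave on $(\underline m,\overline m)$. (b) $\displaystyle\sup_{(\underline m+\varepsilon)n\le k\le(\overline m-\varepsilon)n}\Big|\frac1n\log\mathbb P[S_n=k]-g\Big(\frac kn\Big)\Big|\to0$ as $n\to\infty$. (c) $\displaystyle\sup_{0\le k\le(\underline m-\varepsilon)n}\frac1n\log\mathbb P[S_n=k]\to-\infty$ and $\displaystyle\sup_{(\overline m+\varepsilon)n\le k\le n}\frac1n\log\mathbb P[S_n=k]\to-\infty$ as $n\to\infty$. (d) The function $u\mapsto\Psi(\mathrm e^u)$ is strictly convex on $\mathbb R$, $\Psi$ is differentiable with $\Phi(t)=t\Psi'(t)$ for all $t>0$, $\Phi$ is a bijection from $(0,\infty)$ onto $(\underline m,\overline m)$ and, with $\Phi^{\leftarrow}$ denoting its inverse, for all $\alpha\in(\underline m,\overline m)$, $$g(\alpha)=-\sup_{u\in\mathbb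 R}(\alpha u-\Psi(\mathrm e^u))=\inf_{u\in\mathbb R}(\Psi(\mathrm e^u)-u\alpha)=\Psi(\Phi^{\leftarrow}(\alpha))-\alpha\log\Phi^{\leftarrow}(\alpha).$$ (e) For all $\alpha\in(\underline m,\overline m)$ one has $\mathrm e^{-g'(\alpha)}=\Phi^{\leftarrow}(\alpha)$; the map $\alpha\mapsto g(\alpha)+\alpha\log\alpha$ is strictly concave on $(\underline m,\overline m)$; and $\lim_{\alpha\to\underline m+}g'(\alpha)=+\infty$, $\lim_{\alpha\to\overline m-}g'(\alpha)=-\infty$. (f) The number $p_*:=\int_{[0,1]}y\,M_\infty(\mathrm dy)=\Phi(1)$ satisfies $\underline m<p_*<\overline m$ and $g(p_*)=0$. (g) $\displaystyle\sup_{(\underline m+\varepsilon)n\le k\le(\overline m-\varepsilon)n}\Big|\frac{\mathbb P[S_n=k+1]}{\mathbb P[S_n=k]}-\mathrm e^{g'(k/n)}\Big|\to0$ as $n\to\infty$. (h) The support of $S_n$ is $\{\underline r_n,\dots,\overline r_n\}$, and $$\inf_{\underline r_n\le k\le(\underline m-\varepsilon)n}\frac{\mathbb P[S_n=k+1]}{\mathbb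 P[S_n=k]}\to+\infty,\qquad \inf_{(\overline m+\varepsilon)n\le k<\overline r_n}\frac{\mathbb P[S_n=k]}{\mathbb P[S_n=k+1]}\to+\infty\qquad(n\to\infty).$$ -/

import Mathlib

open Set Filter Topology MeasureTheory ProbabilityTheory unitInterval
open scoped NNReal ENNReal

namespace BernoulliArray

noncomputable section

/-- The row sum `S_n = B_{1:n} + … + B_{n:n}` of a triangular array. -/
def rowSum {Ω : Type*} (B : (n : ℕ) → Fin n → Ω → ℕ) (n : ℕ) (ω : Ω) : ℕ :=
  ∑ k : Fin n, B n k ω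

/-- The probability `P[S_n = k]`. -/
def probSum {Ω : Type*} [MeasurableSpace Ω] (P : Measure Ω)
    (B : (n : ℕ) → Fin n → Ω → ℕ) (n k : ℕ) : ℝ≥0∞ :=
  P {ω | rowSum B n ω = k}

/-- The extended real number `(1/n) log P[S_n = k]`, where `log 0 = -∞`. -/
def logRate {Ω : Type*} [MeasurableSpace Ω] (P : Measure Ω)
    (B : (n : ℕ) → Fin n → Ω → ℕ) (n k : ℕ) : EReal :=
  ENNReal.log (probSum P B n k) / (n : EReal)

/-- The measure `M_n = (1/n) ∑_{k=1}^n δ_{p_{k:n}}` on `[0,1]`. It is a probability measure for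
`n ≥ 1` and the zero measure for `n = 0`, hence it is bundled as a finite measure; the topology
on finite measures is that of weak convergence. -/
def empiricalMeasure (p : (n : ℕ) → Fin n → I) (n : ℕ) : FiniteMeasure I :=
  (n : ℝ≥0)⁻¹ • ∑ k : Fin n, (diracProba (p n k)).toFiniteMeasure

/-- `Ψ(t) = ∫_{[0,1]} log (1 - y + y t) M(dy)`. -/
def Psi (M : ProbabilityMeasure I) (t : ℝ) : ℝ :=
  ∫ y : I, Real.log (1 - (y : ℝ) + y * t) ∂(M : Measure I)

/-- `Φ(t) = t ∫_{[0,1]} y / (1 - y + y t) M(dy)`. -/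
def Phi (M : ProbabilityMeasure I) (t : ℝ) : ℝ :=
  t * ∫ y : I, (y : ℝ) / (1 - (y : ℝ) + y * t) ∂(M : Measure I)

/-- The inverse function of `Φ : (0,∞) → Φ((0,∞))`. -/
def PhiInv (M : ProbabilityMeasure I) (α : ℝ) : ℝ :=
  Function.invFunOn (Phi M) (Ioi 0) α

/-- The number of indices `k` with `p_{k:n} = 1`. -/
def rLower (p : (n : ℕ) → Fin n → I) (n : ℕ) : ℕ :=
  Nat.card {k : Fin n // p n k = 1}

/-- `n` minus the number of indices `k` with `p_{k:n} = 0`. -/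
def rUpper (p : (n : ℕ) → Fin n → I) (n : ℕ) : ℕ :=
  n - Nat.card {k : Fin n // p n k = 0}

end

end BernoulliArray

namespace BernoulliArray

/-! The numbers `P[S_n = k]` are the coefficients `a_k` of `F_n(t) = ∏ (1 - p_i + p_i t)`. Two facts
carry the proof: if the empirical measures tend weakly to `M`, then `(1/n) log F_n(t) → Ψ(t)` for `t
> 0`; and the `a_k` are log-concave (`coeff_genPoly_mul_le`), so `j ↦ a_j t^j` is unimodal.

If `a_{k+1} t ≤ a_k` with `a_k > 0`, the largest term `a_j t^j` occurs at some `j ≤ k`, whence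
`F_n(t) ≤ (n+1) F_n(t') (t/t')^k` for `0 < t' ≤ t`. With `k/n → α`, taking logarithms bounds a
difference quotient of `u ↦ Ψ(e^u)` by `α`. The derivative of that function is `Φ(e^u)`, so the
bound fails for `t'` close to `t` when `α < Φ(t)`. Together with the mirror argument this locates
`a_{k+1}/a_k` relative to `1/t`, wherever the coefficients are positive
(`EmpiricalTendsto.eventually_lt_mul`, `EmpiricalTendsto.eventually_mul_lt`). Hence the ratio tends
to `1/Φ←(α)`, and the Chernoff bound is exponentially sharp, with rate `Ψ(Φ←(α)) - α log Φ←(α)`.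

Weak convergence itself comes from compactness: along every ultrafilter finer than `atTop` the
empirical measures have a limit. Whether the rates are finite or `-∞` identifies the endpoint atoms
of this limit (`atoms_and_rate_of_tendsto`). The rate has derivative `-log Φ←`, so `g` determines
`Φ`, and `Φ` determines all moments (`eq_of_rate_eq`, `eq_of_Phi_eq`). All ultrafilter limits
therefore agree. The same compactness, applied to `k/n` in `[0,1]`, upgrades statements along
sequences to uniform ones (`eventually_forall_of_ultrafilter`). -/

/-- The generating polynomial of a sum of independent Bernoulli variables with parameters `q i`. -/
noncomputable def genPoly {ι : Type*} (s : Finset ι) (q : ι → I) : Polynomial ℝ :=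
  ∏ i ∈ s, (Polynomial.C (1 - (q i : ℝ)) + Polynomial.C (q i : ℝ) * Polynomial.X)

/-! ### Coefficients of the generating polynomial: log-concavity, support, law of the sum, tilted
bounds. -/

section GenPoly

variable {ι : Type*} {s : Finset ι} {q : ι → I}

theorem coeff_genPoly_empty (k : ℕ) :
    (genPoly (∅ : Finset ι) q).coeff k = if k = 0 then 1 else 0 := by
  simp [genPoly, Polynomial.coeff_one]

theorem eval_genPoly (s : Finset ι) (q : ι → I) (t : ℝ) :
    (genPoly s q).eval t = ∏ i ∈ s, (1 - (q i : ℝ) + q i * t) := by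
  simp [genPoly, Polynomial.eval_prod]

theorem natDegree_genPoly_le (s : Finset ι) (q : ι → I) : (genPoly s q).natDegree ≤ s.card := by
  refine (Polynomial.natDegree_prod_le _ _).trans ?_
  refine (Finset.sum_le_card_nsmul s _ 1 fun i _ => ?_).trans (by simp)
  compute_degree

/-- There are at most `s.card + 1` terms; on the scale `(1/n) log` this factor is negligible, so a
polynomial value is as good as its largest term. -/
theorem eval_genPoly_le_of_forall_le {t K : ℝ}
    (h : ∀ j, (genPoly s q).coeff j * t ^ j ≤ K) : (genPoly s q).eval t ≤ (s.card + 1) * K := by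
  rw [Polynomial.eval_eq_sum_range' (Nat.lt_succ_of_le (natDegree_genPoly_le s q))]
  refine (Finset.sum_le_card_nsmul _ _ K fun j _ => h j).trans ?_
  simp

variable [DecidableEq ι]

theorem genPoly_insert {i : ι} (hi : i ∉ s) :
    genPoly (insert i s) q =
      (Polynomial.C (1 - (q i : ℝ)) + Polynomial.C (q i : ℝ) * Polynomial.X) * genPoly s q :=
  Finset.prod_insert hi

theorem coeff_genPoly_insert_zero {i : ι} (hi : i ∉ s) :
    (genPoly (insert i s) q).coeff 0 = (1 - (q i : ℝ)) * (genPoly s q).coeff 0 := by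
  simp [genPoly_insert hi, Polynomial.mul_coeff_zero]

theorem coeff_genPoly_insert_succ {i : ι} (hi : i ∉ s) (k : ℕ) :
    (genPoly (insert i s) q).coeff (k + 1) =
      (1 - (q i : ℝ)) * (genPoly s q).coeff (k + 1) + (q i : ℝ) * (genPoly s q).coeff k := by
  rw [genPoly_insert hi, add_mul, mul_assoc, Polynomial.coeff_add, Polynomial.coeff_C_mul,
    Polynomial.coeff_C_mul, Polynomial.coeff_X_mul]

theorem coeff_genPoly_nonneg (s : Finset ι) (q : ι → I) (k : ℕ) : 0 ≤ (genPoly s q).coeff k := by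
  induction s using Finset.induction_on generalizing k with
  | empty => rw [coeff_genPoly_empty]; positivity
  | insert i s hi ih =>
    have h0 := (q i).2.1
    have h1 : 0 ≤ 1 - (q i : ℝ) := sub_nonneg.2 (q i).2.2
    cases k with
    | zero => rw [coeff_genPoly_insert_zero hi]; exact mul_nonneg h1 (ih 0)
    | succ k =>
      rw [coeff_genPoly_insert_succ hi]
      exact add_nonneg (mul_nonneg h1 (ih _)) (mul_nonneg h0 (ih _))

/-- The coefficients of the generating polynomial form a log-concave sequence. -/
theorem coeff_genPoly_mul_le (s : Finset ι) (q : ι → I) {i j : ℕ} (hij : i ≤ j) :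
    (genPoly s q).coeff i * (genPoly s q).coeff (j + 1) ≤
      (genPoly s q).coeff (i + 1) * (genPoly s q).coeff j := by
  induction s using Finset.induction_on generalizing i j with
  | empty => simp [coeff_genPoly_empty]
  | insert x s hx ih =>
    have h0 : 0 ≤ (q x : ℝ) := (q x).2.1
    have h1 : 0 ≤ 1 - (q x : ℝ) := sub_nonneg.2 (q x).2.2
    rcases hij.eq_or_lt with rfl | hlt
    · exact (mul_comm _ _).le
    obtain ⟨j, rfl⟩ : ∃ j', j = j' + 1 := ⟨j - 1, by omega⟩
    have hc := coeff_genPoly_nonneg s q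
    cases i with
    | zero =>
      rw [coeff_genPoly_insert_zero hx]
      simp only [coeff_genPoly_insert_succ hx]
      generalize 1 - (q x : ℝ) = r at *
      generalize (q x : ℝ) = p at *
      have a1 := ih (i := 0) (j := j + 1) (by omega)
      have a2 := ih (i := 0) (j := j) (by omega)
      have a3 := mul_le_mul_of_nonneg_left a1 (mul_nonneg h1 h1)
      have a5 : 0 ≤ p * p * ((genPoly s q).coeff 0 * (genPoly s q).coeff j) :=
        mul_nonneg (mul_nonneg h0 h0) (mul_nonneg (hc _) (hc _))
      have a6 : 0 ≤ p * r * ((genPoly s q).coeff 1 * (genPoly s q).coeff j) :=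
        mul_nonneg (mul_nonneg h0 h1) (mul_nonneg (hc _) (hc _))
      simp only [zero_add] at *
      nlinarith
    | succ i =>
      simp only [coeff_genPoly_insert_succ hx]
      generalize 1 - (q x : ℝ) = r at *
      generalize (q x : ℝ) = p at *
      have a1 := ih (i := i + 1) (j := j + 1) (by omega)
      have a2 := ih (i := i + 1) (j := j) (by omega)
      have a3 := ih (i := i) (j := j + 1) (by omega)
      have a4 := ih (i := i) (j := j) (by omega)
      -- After expansion the `r²` and `p²` parts are instances of the induction hypothesis. In the
      -- `p r` part one product cancels, and what remains moves both indices by two, hence the chain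
      -- `a3.trans a2`.
      have b1 := mul_le_mul_of_nonneg_left a1 (mul_nonneg h1 h1)
      have b2 := mul_le_mul_of_nonneg_left (a3.trans a2) (mul_nonneg h0 h1)
      have b3 := mul_le_mul_of_nonneg_left a4 (mul_nonneg h0 h0)
      nlinarith

theorem card_one_add_card_zero_le (s : Finset ι) (q : ι → I) :
    (s.filter fun i => q i = 1).card + (s.filter fun i => q i = 0).card ≤ s.card := by
  rw [← Finset.card_union_of_disjoint]
  · exact Finset.card_le_card (by intro i; simp only [Finset.mem_union, Finset.mem_filter]; tauto)
  · exact Finset.disjoint_filter.2 fun i _ h h' => zero_ne_one (h'.symm.trans h)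

/-- A factor with `q i = 1` is `X` and shifts the support, one with `q i = 0` is `1`, and any other
has two positive coefficients and lengthens the support by one. No cancellation can occur, so the
support is an interval. -/
theorem coeff_genPoly_ne_zero_iff (s : Finset ι) (q : ι → I) (k : ℕ) :
    (genPoly s q).coeff k ≠ 0 ↔
      (s.filter fun i => q i = 1).card ≤ k ∧ k + (s.filter fun i => q i = 0).card ≤ s.card := by
  induction s using Finset.induction_on generalizing k with
  | empty => simp [coeff_genPoly_empty]
  | insert x s hx ih =>
    have hle := card_one_add_card_zero_le s q
    have hx1 : x ∉ s.filter fun i => q i = 1 := fun h => hx (Finset.mem_filter.1 h).1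
    have hx0 : x ∉ s.filter fun i => q i = 0 := fun h => hx (Finset.mem_filter.1 h).1
    rw [Finset.filter_insert, Finset.filter_insert, Finset.card_insert_of_notMem hx]
    by_cases h1 : q x = 1
    · have h0 : q x ≠ 0 := by rw [h1]; exact one_ne_zero
      rw [if_pos h1, if_neg h0, Finset.card_insert_of_notMem hx1]
      cases k with
      | zero => rw [coeff_genPoly_insert_zero hx]; simp [h1]
      | succ k =>
        rw [coeff_genPoly_insert_succ hx]
        simp only [h1, Icc.coe_one, sub_self, zero_mul, one_mul, zero_add, ih]
        omega
    · rw [if_neg h1]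
      by_cases h0 : q x = 0
      · rw [if_pos h0, Finset.card_insert_of_notMem hx0]
        cases k with
        | zero =>
          rw [coeff_genPoly_insert_zero hx]
          simp only [h0, Icc.coe_zero, sub_zero, one_mul, ih]
          omega
        | succ k =>
          rw [coeff_genPoly_insert_succ hx]
          simp only [h0, Icc.coe_zero, sub_zero, one_mul, zero_mul, add_zero, ih]
          omega
      · rw [if_neg h0]
        have hp : 0 < (q x : ℝ) := unitInterval.pos_iff_ne_zero.2 h0
        have hr : 0 < 1 - (q x : ℝ) := sub_pos.2 (unitInterval.lt_one_iff_ne_one.2 h1)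
        cases k with
        | zero =>
          rw [coeff_genPoly_insert_zero hx, mul_ne_zero_iff, ih]
          simp only [ne_eq, hr.ne', not_false_eq_true, true_and]
          omega
        | succ k =>
          rw [coeff_genPoly_insert_succ hx]
          have e1 := mul_nonneg hr.le (coeff_genPoly_nonneg s q (k + 1))
          have e2 := mul_nonneg hp.le (coeff_genPoly_nonneg s q k)
          have h3 : (1 - (q x : ℝ)) * (genPoly s q).coeff (k + 1) +
              (q x : ℝ) * (genPoly s q).coeff k ≠ 0 ↔
              (genPoly s q).coeff (k + 1) ≠ 0 ∨ (genPoly s q).coeff k ≠ 0 := by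
            rw [Ne, add_eq_zero_iff_of_nonneg e1 e2]
            simp only [mul_eq_zero, hr.ne', hp.ne', false_or]
            tauto
          rw [h3, ih, ih]
          omega

/-- The law of a sum of independent Bernoulli variables. -/
theorem measure_sum_eq_coeff_genPoly {Ω : Type*} [MeasurableSpace Ω] (P : Measure Ω)
    [IsProbabilityMeasure P] (B : ι → Ω → ℕ) (hB : ∀ i, Measurable (B i)) (hind : iIndepFun B P)
    (hone : ∀ i, P {ω | B i ω = 1} = ENNReal.ofReal (q i : ℝ))
    (hzero : ∀ i, P {ω | B i ω = 0} = ENNReal.ofReal (1 - (q i : ℝ)))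
    (s : Finset ι) (k : ℕ) :
    P {ω | ∑ i ∈ s, B i ω = k} = ENNReal.ofReal ((genPoly s q).coeff k) := by
  induction s using Finset.induction_on generalizing k with
  | empty =>
    rw [coeff_genPoly_empty]
    by_cases hk : k = 0
    · simp [hk]
    · simp [hk, Ne.symm hk]
  | insert x s hx ih =>
    have h0 : 0 ≤ (q x : ℝ) := (q x).2.1
    have h1 : 0 ≤ 1 - (q x : ℝ) := sub_nonneg.2 (q x).2.2
    have hc := coeff_genPoly_nonneg s q
    -- The two prescribed probabilities add up to `1`, which forces the values into `{0, 1}` almost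
    -- surely.
    have hae : ∀ᵐ ω ∂P, B x ω = 0 ∨ B x ω = 1 := by
      have hd : Disjoint {ω | B x ω = 0} {ω | B x ω = 1} := by
        rw [Set.disjoint_left]
        intro ω h h'
        change B x ω = 0 at h
        change B x ω = 1 at h'
        omega
      have hm : MeasurableSet {ω | B x ω = 1} := hB x (measurableSet_singleton 1)
      have hm0 : MeasurableSet {ω | B x ω = 0} := hB x (measurableSet_singleton 0)
      have : P ({ω | B x ω = 0} ∪ {ω | B x ω = 1}) = 1 := by
        rw [measure_union hd hm, hone, hzero, ← ENNReal.ofReal_add h1 h0]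
        simp
      exact (prob_compl_eq_zero_iff (hm0.union hm)).2 this
    have hI : IndepFun (B x) (∑ i ∈ s, B i) P :=
      (hind.indepFun_finsetSum_of_notMem hB hx).symm
    have hprod : ∀ a b : ℕ, P {ω | B x ω = a ∧ ∑ i ∈ s, B i ω = b} =
        P {ω | B x ω = a} * P {ω | ∑ i ∈ s, B i ω = b} := by
      intro a b
      have := hI.measure_inter_preimage_eq_mul {a} {b} (measurableSet_singleton a)
        (measurableSet_singleton b)
      simpa [Set.preimage, Set.inter_def, Finset.sum_apply] using this
    cases k with
    | zero =>
      rw [coeff_genPoly_insert_zero hx, ENNReal.ofReal_mul h1, ← hzero, ← ih, ← hprod]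
      congr 1
      ext ω
      simp [Finset.sum_insert hx]
    | succ k =>
      have hsplit : P {ω | ∑ i ∈ insert x s, B i ω = k + 1} =
          P ({ω | B x ω = 0 ∧ ∑ i ∈ s, B i ω = k + 1} ∪
            {ω | B x ω = 1 ∧ ∑ i ∈ s, B i ω = k}) := by
        refine measure_congr ?_
        filter_upwards [hae] with ω hω
        refine propext ?_
        change (∑ i ∈ insert x s, B i ω = k + 1) ↔ ((B x ω = 0 ∧ ∑ i ∈ s, B i ω = k + 1) ∨
            (B x ω = 1 ∧ ∑ i ∈ s, B i ω = k))
        rw [Finset.sum_insert hx]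
        omega
      rw [hsplit, measure_union, hprod, hprod, hzero, hone, ih, ih, coeff_genPoly_insert_succ hx,
        ENNReal.ofReal_add (mul_nonneg h1 (hc _)) (mul_nonneg h0 (hc _)), ENNReal.ofReal_mul h1,
        ENNReal.ofReal_mul h0]
      · rw [Set.disjoint_left]
        rintro ω ⟨h, _⟩ ⟨h', _⟩
        omega
      · have hs : Measurable fun ω => ∑ i ∈ s, B i ω := Finset.measurable_sum _ fun i _ => hB i
        exact (hB x (measurableSet_singleton 1)).inter (hs (measurableSet_singleton k))

theorem coeff_genPoly_mul_pow_le (s : Finset ι) (q : ι → I) (k : ℕ) {t : ℝ} (ht : 0 ≤ t) :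
    (genPoly s q).coeff k * t ^ k ≤ (genPoly s q).eval t := by
  rcases lt_or_ge s.card k with hk | hk
  · rw [Polynomial.coeff_eq_zero_of_natDegree_lt ((natDegree_genPoly_le s q).trans_lt hk), zero_mul,
      eval_genPoly]
    refine Finset.prod_nonneg fun i _ => ?_
    have h0 : 0 ≤ (q i : ℝ) := (q i).2.1
    have h1 : 0 ≤ 1 - (q i : ℝ) := sub_nonneg.2 (q i).2.2
    positivity
  · rw [Polynomial.eval_eq_sum_range' (Nat.lt_succ_of_le (natDegree_genPoly_le s q))]
    exact Finset.single_le_sum (f := fun k => (genPoly s q).coeff k * t ^ k)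
      (fun j _ => mul_nonneg (coeff_genPoly_nonneg s q j) (pow_nonneg ht j))
      (Finset.mem_range.2 (Nat.lt_succ_of_le hk))

/-- Log-concavity makes the ratios of consecutive coefficients nonincreasing, so once the tilted
sequence fails to increase at `k` it never increases again. The products avoid dividing by
coefficients that may vanish. -/
theorem coeff_genPoly_mul_pow_le_of_ge {k : ℕ} {t : ℝ} (ht : 0 ≤ t)
    (hk : 0 < (genPoly s q).coeff k) (hkt : (genPoly s q).coeff (k + 1) * t ≤ (genPoly s q).coeff k)
    {j : ℕ} (hj : k ≤ j) :
    (genPoly s q).coeff j * t ^ j ≤ (genPoly s q).coeff k * t ^ k := by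
  induction j, hj using Nat.le_induction with
  | base => exact le_rfl
  | succ j hj ih =>
    refine le_trans ?_ ih
    rw [pow_succ, mul_comm (t ^ j), ← mul_assoc]
    refine mul_le_mul_of_nonneg_right ?_ (pow_nonneg ht j)
    refine le_of_mul_le_mul_left ?_ hk
    have := mul_le_mul_of_nonneg_right (coeff_genPoly_mul_le s q hj) ht
    have := mul_le_mul_of_nonneg_right hkt (coeff_genPoly_nonneg s q j)
    nlinarith

theorem coeff_genPoly_mul_pow_le_of_le {k : ℕ} {t : ℝ} (ht : 0 ≤ t)
    (hk : 0 < (genPoly s q).coeff (k + 1))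
    (hkt : (genPoly s q).coeff k ≤ (genPoly s q).coeff (k + 1) * t) {j : ℕ} (hj : j ≤ k + 1) :
    (genPoly s q).coeff j * t ^ j ≤ (genPoly s q).coeff (k + 1) * t ^ (k + 1) := by
  induction hj using Nat.decreasingInduction with
  | self => exact le_rfl
  | of_succ j hj ih =>
    refine le_trans ?_ ih
    rw [pow_succ, mul_comm (t ^ j), ← mul_assoc]
    refine mul_le_mul_of_nonneg_right ?_ (pow_nonneg ht j)
    refine le_of_mul_le_mul_left ?_ hk
    have := coeff_genPoly_mul_le s q (show j ≤ k by omega)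
    have := mul_le_mul_of_nonneg_left hkt (coeff_genPoly_nonneg s q (j + 1))
    nlinarith

/-- If the ratio of consecutive coefficients at `k` is at most `1 / t`, then the value of the
generating polynomial at `t` is controlled by its value at any smaller point. -/
theorem eval_genPoly_le_of_ratio_le {k : ℕ} {t t' : ℝ} (ht' : 0 < t') (htt : t' ≤ t)
    (hk : 0 < (genPoly s q).coeff k)
    (hkt : (genPoly s q).coeff (k + 1) * t ≤ (genPoly s q).coeff k) :
    (genPoly s q).eval t ≤ (s.card + 1) * ((genPoly s q).eval t' * (t / t') ^ k) := by
  have ht : 0 < t := ht'.trans_le htt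
  have h1 : 1 ≤ t / t' := (one_le_div ht').2 htt
  have hmul : ∀ j, (genPoly s q).coeff j * t ^ j =
      (genPoly s q).coeff j * t' ^ j * (t / t') ^ j := by
    intro j; rw [mul_assoc, ← mul_pow, mul_div_cancel₀ _ ht'.ne']
  have hle : ∀ j ≤ k, (genPoly s q).coeff j * t ^ j ≤ (genPoly s q).eval t' * (t / t') ^ k := by
    intro j hj
    have h2 := coeff_genPoly_mul_pow_le s q j ht'.le
    rw [hmul]
    exact mul_le_mul h2 (pow_le_pow_right₀ h1 hj) (by positivity)
      ((mul_nonneg (coeff_genPoly_nonneg s q j) (by positivity)).trans h2)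
  refine eval_genPoly_le_of_forall_le fun j => ?_
  rcases le_total j k with hj | hj
  · exact hle j hj
  · exact (coeff_genPoly_mul_pow_le_of_ge ht.le hk hkt hj).trans (hle k le_rfl)

/-- If the ratio of consecutive coefficients at `k` is at least `1 / t`, then the value of the
generating polynomial at `t` is controlled by its value at any larger point. -/
theorem eval_genPoly_le_of_le_ratio {k : ℕ} {t t' : ℝ} (ht : 0 < t) (htt : t ≤ t')
    (hk : 0 < (genPoly s q).coeff (k + 1))
    (hkt : (genPoly s q).coeff k ≤ (genPoly s q).coeff (k + 1) * t) :
    (genPoly s q).eval t ≤ (s.card + 1) * ((genPoly s q).eval t' * (t / t') ^ (k + 1)) := by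
  have ht' : 0 < t' := ht.trans_le htt
  have h1 : t / t' ≤ 1 := (div_le_one ht').2 htt
  have hmul : ∀ j, (genPoly s q).coeff j * t ^ j =
      (genPoly s q).coeff j * t' ^ j * (t / t') ^ j := by
    intro j; rw [mul_assoc, ← mul_pow, mul_div_cancel₀ _ ht'.ne']
  have hle : ∀ j, k + 1 ≤ j →
      (genPoly s q).coeff j * t ^ j ≤ (genPoly s q).eval t' * (t / t') ^ (k + 1) := by
    intro j hj
    have h2 := coeff_genPoly_mul_pow_le s q j ht'.le
    rw [hmul]
    exact mul_le_mul h2 (pow_le_pow_of_le_one (by positivity) h1 hj) (by positivity)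
      ((mul_nonneg (coeff_genPoly_nonneg s q j) (by positivity)).trans h2)
  refine eval_genPoly_le_of_forall_le fun j => ?_
  rcases le_total (k + 1) j with hj | hj
  · exact hle j hj
  · exact (coeff_genPoly_mul_pow_le_of_le ht.le hk hkt hj).trans (hle (k + 1) le_rfl)

end GenPoly

/-! ### The functions `Ψ` and `Φ` of a fixed measure. -/

section Kernel

theorem den_pos {t : ℝ} (ht : 0 < t) (y : I) : 0 < 1 - (y : ℝ) + y * t := by
  rcases y.2.2.eq_or_lt with h | h
  · rw [h]; linarith
  · have := mul_nonneg y.2.1 ht.le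
    linarith

theorem div_den_nonneg {t : ℝ} (ht : 0 < t) (y : I) : 0 ≤ (y : ℝ) / (1 - (y : ℝ) + y * t) :=
  div_nonneg y.2.1 (den_pos ht y).le

theorem mul_div_den_le_one {t : ℝ} (ht : 0 < t) (y : I) :
    t * ((y : ℝ) / (1 - (y : ℝ) + y * t)) ≤ 1 := by
  rw [← mul_div_assoc, div_le_one (den_pos ht y)]
  have := y.2.2
  linarith

theorem div_den_le {t : ℝ} (ht : 0 < t) (y : I) : (y : ℝ) / (1 - (y : ℝ) + y * t) ≤ 1 / t := by
  rw [le_div_iff₀' ht]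
  exact mul_div_den_le_one ht y

theorem continuous_den (t : ℝ) : Continuous fun y : I => 1 - (y : ℝ) + y * t := by fun_prop

theorem continuous_log_den {t : ℝ} (ht : 0 < t) :
    Continuous fun y : I => Real.log (1 - (y : ℝ) + y * t) :=
  (continuous_den t).log fun y => (den_pos ht y).ne'

theorem continuous_div_den {t : ℝ} (ht : 0 < t) :
    Continuous fun y : I => (y : ℝ) / (1 - (y : ℝ) + y * t) :=
  continuous_subtype_val.div (continuous_den t) fun y => (den_pos ht y).ne'

theorem integrable_of_continuous (M : ProbabilityMeasure I) {f : I → ℝ} (hf : Continuous f) :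
    Integrable f (M : Measure I) :=
  hf.integrable_of_hasCompactSupport (HasCompactSupport.of_compactSpace f)

/-- The integrals `∫ (y / (1 - y + y t)) ^ j M(dy)`. -/
noncomputable def kernelMoment (M : ProbabilityMeasure I) (j : ℕ) (t : ℝ) : ℝ :=
  ∫ y : I, ((y : ℝ) / (1 - (y : ℝ) + y * t)) ^ j ∂(M : Measure I)

variable (M : ProbabilityMeasure I)

theorem Phi_eq (t : ℝ) : Phi M t = t * kernelMoment M 1 t := by simp [Phi, kernelMoment]

theorem hasDerivAt_den (y : I) (t : ℝ) :
    HasDerivAt (fun t : ℝ => 1 - (y : ℝ) + y * t) (y : ℝ) t := by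
  simpa using ((hasDerivAt_id t).const_mul (y : ℝ)).const_add (1 - (y : ℝ))

theorem hasDerivAt_Psi {t : ℝ} (ht : 0 < t) : HasDerivAt (Psi M) (kernelMoment M 1 t) t := by
  -- Away from zero, for arguments above `t / 2`, the kernel is at most `1 / (t / 2)`; this constant
  -- dominates the derivative.
  have hs : Ioi (t / 2) ∈ 𝓝 t := Ioi_mem_nhds (by linarith)
  have hpos : ∀ x ∈ Ioi (t / 2), 0 < x := fun x hx => (half_pos ht).trans hx
  refine (hasDerivAt_integral_of_dominated_loc_of_deriv_le (μ := (M : Measure I))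
    (F := fun t (y : I) => Real.log (1 - (y : ℝ) + y * t))
    (F' := fun t (y : I) => ((y : ℝ) / (1 - (y : ℝ) + y * t)) ^ 1) (bound := fun _ => 1 / (t / 2))
    hs ?_ (integrable_of_continuous M (continuous_log_den ht))
    (integrable_of_continuous M ((continuous_div_den ht).pow 1)).aestronglyMeasurable
    ?_ (integrable_const _) ?_).2
  · filter_upwards [hs] with x hx
    exact (integrable_of_continuous M (continuous_log_den (hpos x hx))).aestronglyMeasurable
  · refine Eventually.of_forall fun y x hx => ?_
    rw [pow_one, Real.norm_of_nonneg (div_den_nonneg (hpos x hx) y)]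
    exact (div_den_le (hpos x hx) y).trans
      (one_div_le_one_div_of_le (half_pos ht) (le_of_lt hx))
  · refine Eventually.of_forall fun y x hx => ?_
    rw [pow_one]
    exact (hasDerivAt_den y x).log (den_pos (hpos x hx) y).ne'

/-- The kernel moments are closed under differentiation up to constants, so smoothness of all of
them follows by induction. -/
theorem hasDerivAt_kernelMoment (j : ℕ) {t : ℝ} (ht : 0 < t) :
    HasDerivAt (kernelMoment M (j + 1)) (-(j + 1) * kernelMoment M (j + 2) t) t := by
  have hs : Ioi (t / 2) ∈ 𝓝 t := Ioi_mem_nhds (by linarith)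
  have hpos : ∀ x ∈ Ioi (t / 2), 0 < x := fun x hx => (half_pos ht).trans hx
  have key := (hasDerivAt_integral_of_dominated_loc_of_deriv_le (μ := (M : Measure I))
    (F := fun t (y : I) => ((y : ℝ) / (1 - (y : ℝ) + y * t)) ^ (j + 1))
    (F' := fun t (y : I) => -((j : ℝ) + 1) * ((y : ℝ) / (1 - (y : ℝ) + y * t)) ^ (j + 2))
    (bound := fun _ => ((j : ℝ) + 1) * (1 / (t / 2)) ^ (j + 2))
    hs ?_ (integrable_of_continuous M ((continuous_div_den ht).pow _))
    (integrable_of_continuous M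
      (((continuous_div_den ht).pow _).const_mul _)).aestronglyMeasurable
    ?_ (integrable_const _) ?_).2
  · rw [integral_const_mul] at key
    exact key
  · filter_upwards [hs] with x hx
    exact (integrable_of_continuous M
      ((continuous_div_den (hpos x hx)).pow _)).aestronglyMeasurable
  · refine Eventually.of_forall fun y x hx => ?_
    have h1 := div_den_nonneg (hpos x hx) y
    have h2 := (div_den_le (hpos x hx) y).trans
      (one_div_le_one_div_of_le (half_pos ht) (le_of_lt hx))
    rw [norm_mul, norm_neg, norm_pow, Real.norm_of_nonneg h1, Real.norm_of_nonneg (by positivity)]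
    gcongr
  · refine Eventually.of_forall fun y x hx => ?_
    have hd := (den_pos (hpos x hx) y).ne'
    have h := (((hasDerivAt_const x (y : ℝ)).div (hasDerivAt_den y x) hd).pow (j + 1))
    refine h.congr_deriv ?_
    have h2 : (0 * (1 - (y : ℝ) + y * x) - (y : ℝ) * y) / (1 - (y : ℝ) + y * x) ^ 2 =
        -((y : ℝ) / (1 - (y : ℝ) + y * x)) ^ 2 := by
      rw [div_pow]; ring
    simp only [Pi.div_apply, Nat.add_sub_cancel, Nat.cast_add, Nat.cast_one, h2]
    ring

theorem contDiffOn_kernelMoment (n j : ℕ) :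
    ContDiffOn ℝ n (kernelMoment M (j + 1)) (Ioi 0) := by
  induction n generalizing j with
  | zero =>
    exact contDiffOn_zero.2 fun t ht =>
      (hasDerivAt_kernelMoment M j ht).continuousAt.continuousWithinAt
  | succ n ih =>
    rw [Nat.cast_add, Nat.cast_one, contDiffOn_succ_iff_deriv_of_isOpen isOpen_Ioi]
    refine ⟨fun t ht =>
      (hasDerivAt_kernelMoment M j ht).differentiableAt.differentiableWithinAt, by simp, ?_⟩
    refine ((contDiffOn_const (c := -((j : ℝ) + 1))).mul (ih (j + 1))).congr fun t ht => ?_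
    exact (hasDerivAt_kernelMoment M j ht).deriv

theorem hasDerivAt_Phi {t : ℝ} (ht : 0 < t) :
    HasDerivAt (Phi M) (kernelMoment M 1 t - t * kernelMoment M 2 t) t := by
  have h := (hasDerivAt_id t).mul (hasDerivAt_kernelMoment M 0 ht)
  have e : Phi M = id * kernelMoment M (0 + 1) := by
    funext t; exact Phi_eq M t
  rw [e]
  refine h.congr_deriv ?_
  simp
  ring

/-- The left side is the derivative of `Φ`. Written this way, its integrand is visibly nonnegative
and vanishes only at the endpoints of `[0,1]`. -/
theorem kernelMoment_sub_eq {t : ℝ} (ht : 0 < t) :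
    kernelMoment M 1 t - t * kernelMoment M 2 t =
      ∫ y : I, (y : ℝ) * (1 - y) / (1 - (y : ℝ) + y * t) ^ 2 ∂(M : Measure I) := by
  rw [kernelMoment, kernelMoment, ← integral_const_mul, ← integral_sub]
  · refine integral_congr_ae (Eventually.of_forall fun y => ?_)
    have := (den_pos ht y).ne'
    field_simp
    ring
  · exact integrable_of_continuous M ((continuous_div_den ht).pow 1)
  · exact integrable_of_continuous M (((continuous_div_den ht).pow 2).const_mul t)

theorem hasDerivAt_Psi_exp (u : ℝ) :
    HasDerivAt (fun u => Psi M (Real.exp u)) (Phi M (Real.exp u)) u := by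
  refine ((hasDerivAt_Psi M (Real.exp_pos u)).comp u (Real.hasDerivAt_exp u)).congr_deriv ?_
  rw [Phi_eq, mul_comm]

theorem Phi_eq_integral (t : ℝ) :
    Phi M t = ∫ y : I, t * ((y : ℝ) / (1 - (y : ℝ) + y * t)) ∂(M : Measure I) := by
  rw [Phi, integral_const_mul]

/-- The integrand of `Φ` lies in `[0,1]` and tends pointwise to the indicator of `{1}` as `t → 0+`;
dominated convergence applies. At infinity the limit is the indicator of the complement of `{0}`. -/
theorem tendsto_Phi_zero : Tendsto (Phi M) (𝓝[>] 0) (𝓝 ((M : Measure I).real {1})) := by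
  rw [← integral_indicator_one (measurableSet_singleton (1 : I))]
  rw [show Phi M = _ from funext (Phi_eq_integral M)]
  refine tendsto_integral_filter_of_dominated_convergence (fun _ => 1) ?_ ?_
    (integrable_const _) ?_
  · filter_upwards [self_mem_nhdsWithin] with t ht
    exact (integrable_of_continuous M
      ((continuous_div_den ht).const_mul t)).aestronglyMeasurable
  · filter_upwards [self_mem_nhdsWithin] with t ht
    refine Eventually.of_forall fun y => ?_
    rw [Real.norm_of_nonneg (mul_nonneg (le_of_lt ht) (div_den_nonneg ht y))]
    exact mul_div_den_le_one ht y
  · refine Eventually.of_forall fun y => ?_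
    by_cases hy : y = 1
    · rw [indicator_of_mem (show y ∈ ({1} : Set I) from hy)]
      refine tendsto_const_nhds.congr' ?_
      filter_upwards [self_mem_nhdsWithin] with t ht
      have : t ≠ 0 := (ne_of_gt ht)
      simp [hy, this]
    · rw [indicator_of_notMem (show y ∉ ({1} : Set I) from hy)]
      have hy1 : 0 < 1 - (y : ℝ) := sub_pos.2 (unitInterval.lt_one_iff_ne_one.2 hy)
      have : ContinuousAt (fun t : ℝ => t * ((y : ℝ) / (1 - (y : ℝ) + y * t))) 0 := by
        refine continuousAt_id.mul (continuousAt_const.div (by fun_prop) ?_)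
        simpa using hy1.ne'
      simpa using this.tendsto.mono_left nhdsWithin_le_nhds

theorem tendsto_Phi_atTop :
    Tendsto (Phi M) atTop (𝓝 (1 - (M : Measure I).real {0})) := by
  rw [← probReal_compl_eq_one_sub (measurableSet_singleton (0 : I)),
    ← integral_indicator_one (measurableSet_singleton (0 : I)).compl]
  rw [show Phi M = _ from funext (Phi_eq_integral M)]
  refine tendsto_integral_filter_of_dominated_convergence (fun _ => 1) ?_ ?_
    (integrable_const _) ?_
  · filter_upwards [eventually_gt_atTop 0] with t ht
    exact (integrable_of_continuous M
      ((continuous_div_den ht).const_mul t)).aestronglyMeasurable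
  · filter_upwards [eventually_gt_atTop 0] with t ht
    refine Eventually.of_forall fun y => ?_
    rw [Real.norm_of_nonneg (mul_nonneg (le_of_lt ht) (div_den_nonneg ht y))]
    exact mul_div_den_le_one ht y
  · refine Eventually.of_forall fun y => ?_
    by_cases hy : y = 0
    · rw [indicator_of_notMem (by simp [hy])]
      simp [hy]
    · rw [indicator_of_mem (show y ∈ ({0} : Set I)ᶜ from hy)]
      have hy0 : 0 < (y : ℝ) := unitInterval.pos_iff_ne_zero.2 hy
      have h1 : Tendsto (fun t : ℝ => 1 - (1 - (y : ℝ)) / (1 - (y : ℝ) + y * t)) atTop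
          (𝓝 (1 - 0)) := by
        refine tendsto_const_nhds.sub (tendsto_const_nhds.div_atTop ?_)
        exact tendsto_atTop_add_const_left _ _ (tendsto_id.const_mul_atTop hy0)
      rw [sub_zero] at h1
      refine h1.congr' ?_
      filter_upwards [eventually_gt_atTop 0] with t ht
      have := (den_pos ht y).ne'
      field_simp
      ring

theorem Psi_one : Psi M 1 = 0 := by simp [Psi]

theorem Phi_one : Phi M 1 = ∫ y : I, (y : ℝ) ∂(M : Measure I) := by simp [Phi]

/-- Bounds for `Ψ(e^u)` in terms of the atoms of `M`. -/
theorem Psi_exp_le_of_nonpos {u : ℝ} (hu : u ≤ 0) :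
    Psi M (Real.exp u) ≤ u * (M : Measure I).real {1} := by
  rw [← integral_indicator_one (measurableSet_singleton (1 : I)), ← integral_const_mul]
  refine integral_mono (integrable_of_continuous M (continuous_log_den (Real.exp_pos u)))
    (((integrable_const (1 : ℝ)).indicator (measurableSet_singleton _)).const_mul u) fun y => ?_
  by_cases hy : y = 1
  · simp [hy]
  · simp only [mem_singleton_iff, hy, not_false_eq_true, indicator_of_notMem, mul_zero]
    refine Real.log_nonpos (den_pos (Real.exp_pos u) y).le ?_
    have := mul_le_mul_of_nonneg_left (Real.exp_le_one_iff.2 hu) y.2.1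
    linarith

/-- For `u ≥ 0` the average `1 - y + y e^u` of `1` and `e^u` is at most `e^u`, and it equals `1` at
`y = 0`. -/
theorem Psi_exp_le_of_nonneg {u : ℝ} (hu : 0 ≤ u) :
    Psi M (Real.exp u) ≤ u * (1 - (M : Measure I).real {0}) := by
  rw [← probReal_compl_eq_one_sub (measurableSet_singleton (0 : I)),
    ← integral_indicator_one (measurableSet_singleton (0 : I)).compl, ← integral_const_mul]
  refine integral_mono (integrable_of_continuous M (continuous_log_den (Real.exp_pos u)))
    (((integrable_const (1 : ℝ)).indicator (measurableSet_singleton _).compl).const_mul u)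
    fun y => ?_
  by_cases hy : y = 0
  · simp [hy]
  · simp only [mem_compl_iff, mem_singleton_iff, hy, not_false_eq_true, indicator_of_mem,
      Pi.one_apply, mul_one]
    rw [Real.log_le_iff_le_exp (den_pos (Real.exp_pos u) y)]
    have h1 := Real.one_le_exp hu
    have := y.2.2
    nlinarith

/-- A finite measure on `[0,1]` is determined by the function `Φ`. -/
theorem eq_of_Phi_eq {M N : ProbabilityMeasure I} (h : ∀ t, 0 < t → Phi M t = Phi N t) :
    M = N := by
  -- With `t = 1 + s` the denominator is `1 + s y`; at `s = 0` it disappears and these integrals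
  -- become the moments. The power of `y` is raised inductively, and the numerator starts at `y`
  -- because `Φ` supplies exactly that case.
  have hker : ∀ k : ℕ, ∀ s : ℝ, 0 ≤ s →
      ∫ y : I, (y : ℝ) ^ (k + 1) / (1 - (y : ℝ) + y * (1 + s)) ∂(M : Measure I) =
      ∫ y : I, (y : ℝ) ^ (k + 1) / (1 - (y : ℝ) + y * (1 + s)) ∂(N : Measure I) := by
    intro k
    induction k with
    | zero =>
      intro s hs
      have h1 := h (1 + s) (by linarith)
      simp only [Phi] at h1
      simpa using mul_left_cancel₀ (by linarith) h1
    | succ k ih =>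
      have hcont : ∀ s : ℝ, 0 ≤ s → Continuous fun y : I =>
          (y : ℝ) ^ (k + 1 + 1) / (1 - (y : ℝ) + y * (1 + s)) := fun s hs =>
        (continuous_subtype_val.pow _).div (continuous_den _) fun y =>
          (den_pos (by linarith : 0 < 1 + s) y).ne'
      have hpos : ∀ s : ℝ, 0 < s →
          ∫ y : I, (y : ℝ) ^ (k + 1 + 1) / (1 - (y : ℝ) + y * (1 + s)) ∂(M : Measure I) =
          ∫ y : I, (y : ℝ) ^ (k + 1 + 1) / (1 - (y : ℝ) + y * (1 + s)) ∂(N : Measure I) := by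
        intro s hs
        -- This is `s y / (1 + s y) = 1 - 1 / (1 + s y)` multiplied by `y^(k+1)`. It needs `s ≠ 0`,
        -- so the case `s = 0` is recovered below as a limit.
        have hrec : ∀ L : ProbabilityMeasure I,
            ∫ y : I, (y : ℝ) ^ (k + 1 + 1) / (1 - (y : ℝ) + y * (1 + s)) ∂(L : Measure I) =
            s⁻¹ * (∫ y : I, (y : ℝ) ^ (k + 1) / (1 - (y : ℝ) + y * (1 + 0)) ∂(L : Measure I) -
              ∫ y : I, (y : ℝ) ^ (k + 1) / (1 - (y : ℝ) + y * (1 + s)) ∂(L : Measure I)) := by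
          intro L
          rw [← integral_sub, ← integral_const_mul]
          · refine integral_congr_ae (Eventually.of_forall fun y => ?_)
            have h1 := (den_pos (by linarith : 0 < 1 + s) y).ne'
            have h2 : 1 - (y : ℝ) + y * (1 + 0) = 1 := by ring
            simp only [h2]
            field_simp
            ring
          · refine integrable_of_continuous L ((continuous_subtype_val.pow _).div
              (continuous_den _) fun y => (den_pos (by norm_num) y).ne')
          · refine integrable_of_continuous L ((continuous_subtype_val.pow _).div
              (continuous_den _) fun y => (den_pos (by linarith) y).ne')
        rw [hrec M, hrec N, ih 0 le_rfl, ih s hs.le]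
      intro s hs
      rcases hs.eq_or_lt with rfl | hs
      · have hlim : ∀ L : ProbabilityMeasure I, Tendsto (fun s : ℝ =>
            ∫ y : I, (y : ℝ) ^ (k + 1 + 1) / (1 - (y : ℝ) + y * (1 + s)) ∂(L : Measure I))
            (𝓝[>] 0) (𝓝 (∫ y : I, (y : ℝ) ^ (k + 1 + 1) / (1 - (y : ℝ) + y * (1 + 0))
              ∂(L : Measure I))) := by
          intro L
          refine tendsto_integral_filter_of_dominated_convergence (fun _ => 1) ?_ ?_
            (integrable_const _) ?_
          · filter_upwards [self_mem_nhdsWithin] with s hs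
            exact (integrable_of_continuous L (hcont s (le_of_lt hs))).aestronglyMeasurable
          · filter_upwards [self_mem_nhdsWithin] with s hs
            refine Eventually.of_forall fun y => ?_
            have hs : 0 < s := hs
            have hd := den_pos (by linarith : 0 < 1 + s) y
            have hy := mul_nonneg y.2.1 hs.le
            rw [Real.norm_of_nonneg (div_nonneg (pow_nonneg y.2.1 _) hd.le), div_le_one hd]
            refine (pow_le_one₀ y.2.1 y.2.2).trans ?_
            linarith
          · refine Eventually.of_forall fun y => ?_
            have : ContinuousAt (fun s : ℝ =>
                (y : ℝ) ^ (k + 1 + 1) / (1 - (y : ℝ) + y * (1 + s))) 0 :=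
              continuousAt_const.div (by fun_prop) (den_pos (by norm_num) y).ne'
            exact this.tendsto.mono_left nhdsWithin_le_nhds
        refine tendsto_nhds_unique (hlim M) ((hlim N).congr' ?_)
        filter_upwards [self_mem_nhdsWithin] with s hs
        exact (hpos s hs).symm
      · exact hpos s hs
  have hmom : ∀ k : ℕ, ∫ y : I, (y : ℝ) ^ k ∂(M : Measure I) =
      ∫ y : I, (y : ℝ) ^ k ∂(N : Measure I) := by
    intro k
    cases k with
    | zero => simp
    | succ k => simpa using hker k 0 le_rfl
  have hpoly : ∀ r : Polynomial ℝ, ∫ y : I, r.eval (y : ℝ) ∂(M : Measure I) =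
      ∫ y : I, r.eval (y : ℝ) ∂(N : Measure I) := by
    intro r
    simp only [Polynomial.eval_eq_sum_range]
    rw [integral_finsetSum, integral_finsetSum]
    · simp only [integral_const_mul, hmom]
    all_goals
      exact fun i _ => integrable_of_continuous _ ((continuous_subtype_val.pow i).const_mul _)
  have hall : ∀ f : C(I, ℝ), ∫ y, f y ∂(M : Measure I) = ∫ y, f y ∂(N : Measure I) := by
    intro f
    -- Weierstrass: both integrals are continuous in `f` for the uniform norm and agree on
    -- polynomials.
    have hcl : f ∈ closure (polynomialFunctions I : Set C(I, ℝ)) := by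
      have := polynomialFunctions_closure_eq_top 0 1
      have h2 : f ∈ (polynomialFunctions (Set.Icc (0 : ℝ) 1)).topologicalClosure := by
        rw [this]; trivial
      exact h2
    have hc : ∀ L : ProbabilityMeasure I,
        Continuous fun f : C(I, ℝ) => ∫ y, f y ∂(L : Measure I) := by
      intro L
      refine (LipschitzWith.of_dist_le_mul (K := 1) fun f g => ?_).continuous
      rw [dist_eq_norm, ← integral_sub (integrable_of_continuous L f.continuous)
        (integrable_of_continuous L g.continuous)]
      refine (norm_integral_le_of_norm_le_const (C := dist f g) (Eventually.of_forall fun y =>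
        ?_)).trans (by simp)
      rw [← dist_eq_norm]
      exact ContinuousMap.dist_apply_le_dist y
    refine closure_minimal ?_ (isClosed_eq (hc M) (hc N)) hcl
    rintro _ ⟨r, -, rfl⟩
    exact hpoly r
  refine Subtype.ext (ext_of_forall_integral_eq_of_IsFiniteMeasure
    (μ := (M : Measure I)) (ν := (N : Measure I)) fun f => ?_)
  exact hall f.toContinuousMap

variable (M : ProbabilityMeasure I)

/-! ### Inverse of `Φ` and the rate function, for a measure not carried by `{0, 1}`. -/

section Nondegenerate

variable {M}
variable (hM : (M : Measure I).real {1} < 1 - (M : Measure I).real {0})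
include hM

/-- The hypothesis `hM` says that the two endpoint atoms have total mass below one, so the open
interval has positive mass. -/
theorem integral_pos_of_pos {f : I → ℝ} (hf : Continuous f) (hnn : ∀ y, 0 ≤ f y)
    (hpos : ∀ y : I, 0 < (y : ℝ) → 0 < 1 - (y : ℝ) → 0 < f y) :
    0 < ∫ y, f y ∂(M : Measure I) := by
  rw [integral_pos_iff_support_of_nonneg hnn (integrable_of_continuous M hf)]
  have hsub : ({1, 0} : Set I)ᶜ ⊆ Function.support f := by
    intro y hy
    simp only [mem_compl_iff, mem_insert_iff, mem_singleton_iff, not_or] at hy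
    exact (hpos y (unitInterval.pos_iff_ne_zero.2 hy.2)
      (sub_pos.2 (unitInterval.lt_one_iff_ne_one.2 hy.1))).ne'
  refine lt_of_lt_of_le ?_ (measure_mono hsub)
  have hms : MeasurableSet ({1, 0} : Set I) := (Set.toFinite _).measurableSet
  have h2 : (M : Measure I).real {1, 0} ≤
      (M : Measure I).real {1} + (M : Measure I).real {0} := measureReal_union_le _ _
  have h3 := probReal_compl_eq_one_sub (μ := (M : Measure I)) hms
  have h4 : 0 < (M : Measure I).real ({1, 0} : Set I)ᶜ := by linarith
  exact (ENNReal.toReal_pos_iff.1 h4).1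

theorem kernelMoment_sub_pos {t : ℝ} (ht : 0 < t) :
    0 < kernelMoment M 1 t - t * kernelMoment M 2 t := by
  rw [kernelMoment_sub_eq M ht]
  refine integral_pos_of_pos hM
    ((by fun_prop : Continuous fun y : I => (y : ℝ) * (1 - y)).div ((continuous_den t).pow 2)
      fun y => (pow_pos (den_pos ht y) 2).ne')
    (fun y => div_nonneg (mul_nonneg y.2.1 (sub_nonneg.2 y.2.2)) (sq_nonneg _)) fun y h0 h1 => ?_
  exact div_pos (mul_pos h0 h1) (pow_pos (den_pos ht y) 2)

theorem kernelMoment_pos (j : ℕ) {t : ℝ} (ht : 0 < t) : 0 < kernelMoment M j t :=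
  integral_pos_of_pos hM ((continuous_div_den ht).pow j)
    (fun y => pow_nonneg (div_den_nonneg ht y) j)
    fun y h0 _ => pow_pos (div_pos h0 (den_pos ht y)) j

theorem strictMonoOn_Phi : StrictMonoOn (Phi M) (Ioi 0) := by
  refine strictMonoOn_of_deriv_pos (convex_Ioi 0)
    (fun t ht => (hasDerivAt_Phi M ht).continuousAt.continuousWithinAt) fun t ht => ?_
  rw [interior_Ioi] at ht
  rw [(hasDerivAt_Phi M ht).deriv]
  exact kernelMoment_sub_pos hM ht

theorem Phi_gt {t : ℝ} (ht : 0 < t) : (M : Measure I).real {1} < Phi M t := by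
  have h2 : 0 < t / 2 := half_pos ht
  refine lt_of_le_of_lt (le_of_tendsto (tendsto_Phi_zero M) ?_)
    (strictMonoOn_Phi hM h2 ht (half_lt_self ht))
  filter_upwards [Ioo_mem_nhdsGT h2] with s hs
  exact (strictMonoOn_Phi hM hs.1 h2 hs.2).le

theorem Phi_lt {t : ℝ} (ht : 0 < t) : Phi M t < 1 - (M : Measure I).real {0} := by
  have h2 : 0 < t + 1 := by linarith
  refine (strictMonoOn_Phi hM ht h2 (lt_add_one t)).trans_le
    (ge_of_tendsto (tendsto_Phi_atTop M) ?_)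
  filter_upwards [eventually_gt_atTop (t + 1)] with s hs
  exact (strictMonoOn_Phi hM h2 (h2.trans hs) hs).le

theorem bijOn_Phi :
    BijOn (Phi M) (Ioi 0) (Ioo ((M : Measure I).real {1}) (1 - (M : Measure I).real {0})) := by
  refine ⟨fun t ht => ⟨Phi_gt hM ht, Phi_lt hM ht⟩, (strictMonoOn_Phi hM).injOn, ?_⟩
  rintro α ⟨h1, h2⟩
  obtain ⟨s, hs, hs0⟩ := (((tendsto_Phi_zero M).eventually_lt_const h1).and
    self_mem_nhdsWithin).exists
  obtain ⟨r, hr, hr0⟩ := (((tendsto_Phi_atTop M).eventually_const_lt h2).and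
    (eventually_gt_atTop s)).exists
  have hc : ContinuousOn (Phi M) (Icc s r) := fun t ht =>
    (hasDerivAt_Phi M (lt_of_lt_of_le hs0 ht.1)).continuousAt.continuousWithinAt
  obtain ⟨t, ht, hta⟩ := intermediate_value_Icc hr0.le hc ⟨hs.le, hr.le⟩
  exact ⟨t, lt_of_lt_of_le hs0 ht.1, hta⟩

theorem PhiInv_pos {α : ℝ}
    (hα : α ∈ Ioo ((M : Measure I).real {1}) (1 - (M : Measure I).real {0})) :
    0 < PhiInv M α :=
  Function.invFunOn_mem ((bijOn_Phi hM).surjOn hα)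

theorem Phi_PhiInv {α : ℝ}
    (hα : α ∈ Ioo ((M : Measure I).real {1}) (1 - (M : Measure I).real {0})) :
    Phi M (PhiInv M α) = α :=
  Function.invFunOn_eq ((bijOn_Phi hM).surjOn hα)

theorem PhiInv_Phi {t : ℝ} (ht : 0 < t) : PhiInv M (Phi M t) = t :=
  (bijOn_Phi hM).injOn (PhiInv_pos hM ((bijOn_Phi hM).mapsTo ht)) ht
    (Phi_PhiInv hM ((bijOn_Phi hM).mapsTo ht))

theorem strictMonoOn_PhiInv :
    StrictMonoOn (PhiInv M)
      (Ioo ((M : Measure I).real {1}) (1 - (M : Measure I).real {0})) := by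
  intro α hα β hβ h
  rw [← (strictMonoOn_Phi hM).lt_iff_lt (PhiInv_pos hM hα) (PhiInv_pos hM hβ), Phi_PhiInv hM hα,
    Phi_PhiInv hM hβ]
  exact h

theorem continuousAt_PhiInv {α : ℝ}
    (hα : α ∈ Ioo ((M : Measure I).real {1}) (1 - (M : Measure I).real {0})) :
    ContinuousAt (PhiInv M) α := by
  refine (strictMonoOn_PhiInv hM).continuousAt_of_image_mem_nhds (Ioo_mem_nhds hα.1 hα.2) ?_
  refine mem_of_superset (Ioi_mem_nhds (PhiInv_pos hM hα)) fun t ht => ?_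
  exact ⟨Phi M t, (bijOn_Phi hM).mapsTo ht, PhiInv_Phi hM ht⟩

theorem hasDerivAt_PhiInv {α : ℝ}
    (hα : α ∈ Ioo ((M : Measure I).real {1}) (1 - (M : Measure I).real {0})) :
    HasDerivAt (PhiInv M) (kernelMoment M 1 (PhiInv M α) -
      PhiInv M α * kernelMoment M 2 (PhiInv M α))⁻¹ α := by
  refine HasDerivAt.of_local_left_inverse (continuousAt_PhiInv hM hα)
    (hasDerivAt_Phi M (PhiInv_pos hM hα)) (kernelMoment_sub_pos hM (PhiInv_pos hM hα)).ne' ?_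
  filter_upwards [Ioo_mem_nhds hα.1 hα.2] with β hβ using Phi_PhiInv hM hβ

/-- Bootstrap: the derivative of the inverse is a smooth expression in the inverse itself, so each
order of differentiability yields the next. -/
theorem contDiffOn_PhiInv (n : ℕ) :
    ContDiffOn ℝ n (PhiInv M)
      (Ioo ((M : Measure I).real {1}) (1 - (M : Measure I).real {0})) := by
  induction n with
  | zero =>
    exact contDiffOn_zero.2 fun α hα => (continuousAt_PhiInv hM hα).continuousWithinAt
  | succ n ih =>
    rw [Nat.cast_add, Nat.cast_one, contDiffOn_succ_iff_deriv_of_isOpen isOpen_Ioo]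
    refine ⟨fun α hα => (hasDerivAt_PhiInv hM hα).differentiableAt.differentiableWithinAt,
      by simp, ?_⟩
    have hmaps : MapsTo (PhiInv M)
        (Ioo ((M : Measure I).real {1}) (1 - (M : Measure I).real {0})) (Ioi 0) :=
      fun α hα => PhiInv_pos hM hα
    have h1 := (contDiffOn_kernelMoment M n 0).comp ih hmaps
    have h2 := (contDiffOn_kernelMoment M n 1).comp ih hmaps
    refine ((h1.sub (ih.mul h2)).inv fun α hα =>
      (kernelMoment_sub_pos hM (PhiInv_pos hM hα)).ne').congr fun α hα => ?_
    exact (hasDerivAt_PhiInv hM hα).deriv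

/-- The derivative of the rate function. -/
theorem hasDerivAt_rate {α : ℝ}
    (hα : α ∈ Ioo ((M : Measure I).real {1}) (1 - (M : Measure I).real {0})) :
    HasDerivAt (fun α => Psi M (PhiInv M α) - α * Real.log (PhiInv M α))
      (-Real.log (PhiInv M α)) α := by
  have hp := PhiInv_pos hM hα
  have h := hasDerivAt_PhiInv hM hα
  refine (((hasDerivAt_Psi M hp).comp α h).sub
    ((hasDerivAt_id α).mul (h.log hp.ne'))).congr_deriv ?_
  -- This is the stationarity of `Ψ(t) - α log t` at `t = Φ←(α)`; because of it the terms containing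
  -- the derivative of `Φ←` cancel.
  have hphi : PhiInv M α * kernelMoment M 1 (PhiInv M α) = α := by
    rw [← Phi_eq, Phi_PhiInv hM hα]
  have h3 : kernelMoment M 1 (PhiInv M α) = α / PhiInv M α := by
    rw [eq_div_iff hp.ne', mul_comm]; exact hphi
  simp only [id]
  generalize (kernelMoment M 1 (PhiInv M α) - PhiInv M α * kernelMoment M 2 (PhiInv M α))⁻¹ = x
  rw [h3]
  field_simp
  ring

theorem tendsto_PhiInv_left :
    Tendsto (PhiInv M) (𝓝[>] ((M : Measure I).real {1})) (𝓝[>] 0) := by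
  rw [tendsto_nhdsWithin_iff]
  have hmem : Ioo ((M : Measure I).real {1}) (1 - (M : Measure I).real {0}) ∈
      𝓝[>] ((M : Measure I).real {1}) := Ioo_mem_nhdsGT hM
  refine ⟨tendsto_order.2 ⟨fun b hb => ?_, fun b hb => ?_⟩, ?_⟩
  · filter_upwards [hmem] with α hα using hb.trans (PhiInv_pos hM hα)
  · filter_upwards [Ioo_mem_nhdsGT (Phi_gt hM hb)] with α hα
    have hα' : α ∈ Ioo ((M : Measure I).real {1}) (1 - (M : Measure I).real {0}) :=
      ⟨hα.1, hα.2.trans (Phi_lt hM hb)⟩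
    rw [← (strictMonoOn_Phi hM).lt_iff_lt (PhiInv_pos hM hα') hb, Phi_PhiInv hM hα']
    exact hα.2
  · filter_upwards [hmem] with α hα using PhiInv_pos hM hα

theorem tendsto_PhiInv_right :
    Tendsto (PhiInv M) (𝓝[<] (1 - (M : Measure I).real {0})) atTop := by
  refine tendsto_atTop.2 fun b => ?_
  have hb : 0 < max b 1 := lt_max_of_lt_right one_pos
  filter_upwards [Ioo_mem_nhdsLT (Phi_lt hM hb)] with α hα
  have hα' : α ∈ Ioo ((M : Measure I).real {1}) (1 - (M : Measure I).real {0}) :=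
    ⟨(Phi_gt hM hb).trans hα.1, hα.2⟩
  refine (le_max_left b 1).trans (le_of_lt ?_)
  rw [← (strictMonoOn_Phi hM).lt_iff_lt hb (PhiInv_pos hM hα'), Phi_PhiInv hM hα']
  exact hα.1

theorem strictConvexOn_Psi_exp : StrictConvexOn ℝ univ fun u => Psi M (Real.exp u) := by
  refine StrictMono.strictConvexOn_univ_of_deriv (continuous_iff_continuousAt.2 fun u =>
    (hasDerivAt_Psi_exp M u).continuousAt) ?_
  rw [show deriv (fun u => Psi M (Real.exp u)) = fun u => Phi M (Real.exp u) from
    funext fun u => (hasDerivAt_Psi_exp M u).deriv]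
  exact fun u v h => strictMonoOn_Phi hM (Real.exp_pos u) (Real.exp_pos v) (Real.exp_lt_exp.2 h)

/-- The rate function is the minimal value of `u ↦ Ψ(e^u) - u α`. -/
theorem rate_le {α : ℝ}
    (hα : α ∈ Ioo ((M : Measure I).real {1}) (1 - (M : Measure I).real {0})) (u : ℝ) :
    Psi M (PhiInv M α) - α * Real.log (PhiInv M α) ≤ Psi M (Real.exp u) - u * α := by
  have hp := PhiInv_pos hM hα
  have hd := hasDerivAt_Psi_exp M (Real.log (PhiInv M α))
  rw [Real.exp_log hp, Phi_PhiInv hM hα] at hd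
  -- At `log Φ←(α)` the convex function has slope `α`, so it lies above its tangent of slope `α`
  -- there.
  have hmin := (strictConvexOn_Psi_exp hM).convexOn
  rcases lt_trichotomy u (Real.log (PhiInv M α)) with h | h | h
  · have := hmin.slope_le_of_hasDerivAt (mem_univ u) (mem_univ _) h hd
    rw [slope_def_field, div_le_iff₀ (sub_pos.2 h), Real.exp_log hp] at this
    linarith
  · rw [h, Real.exp_log hp, mul_comm]
  · have := hmin.le_slope_of_hasDerivAt (mem_univ _) (mem_univ u) h hd
    rw [slope_def_field, le_div_iff₀ (sub_pos.2 h), Real.exp_log hp] at this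
    linarith

theorem strictConcaveOn_rate :
    StrictConcaveOn ℝ (Ioo ((M : Measure I).real {1}) (1 - (M : Measure I).real {0}))
      fun α => Psi M (PhiInv M α) - α * Real.log (PhiInv M α) := by
  refine StrictAntiOn.strictConcaveOn_of_deriv (convex_Ioo _ _)
    (fun α hα => (hasDerivAt_rate hM hα).continuousAt.continuousWithinAt) ?_
  rw [interior_Ioo]
  intro α hα β hβ h
  rw [(hasDerivAt_rate hM hα).deriv, (hasDerivAt_rate hM hβ).deriv]
  exact neg_lt_neg (Real.log_lt_log (PhiInv_pos hM hα) (strictMonoOn_PhiInv hM hα hβ h))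

theorem kernelMoment_one_strictAntiOn : StrictAntiOn (kernelMoment M 1) (Ioi 0) := by
  refine strictAntiOn_of_deriv_neg (convex_Ioi 0)
    (fun t ht => (hasDerivAt_kernelMoment M 0 ht).continuousAt.continuousWithinAt) fun t ht => ?_
  rw [interior_Ioi] at ht
  have ht : 0 < t := ht
  rw [(hasDerivAt_kernelMoment M 0 ht).deriv]
  have h2 := kernelMoment_pos hM 2 ht
  simp only [Nat.cast_zero, zero_add]
  linarith

/-- With `t = Φ←(α)` the derivative is `-log t + log α + 1`. Since `α = t * kernelMoment M 1 t`, it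
equals `log (kernelMoment M 1 t) + 1`; the moment strictly decreases in `t`, and `t` strictly
increases in `α`. -/
theorem strictConcaveOn_rate_add :
    StrictConcaveOn ℝ (Ioo ((M : Measure I).real {1}) (1 - (M : Measure I).real {0}))
      fun α => Psi M (PhiInv M α) - α * Real.log (PhiInv M α) + α * Real.log α := by
  have hpos : ∀ α ∈ Ioo ((M : Measure I).real {1}) (1 - (M : Measure I).real {0}), 0 < α :=
    fun α hα => measureReal_nonneg.trans_lt hα.1
  have hd : ∀ α ∈ Ioo ((M : Measure I).real {1}) (1 - (M : Measure I).real {0}),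
      HasDerivAt (fun α => Psi M (PhiInv M α) - α * Real.log (PhiInv M α) + α * Real.log α)
        (Real.log (kernelMoment M 1 (PhiInv M α)) + 1) α := by
    intro α hα
    refine ((hasDerivAt_rate hM hα).add (Real.hasDerivAt_mul_log (hpos α hα).ne')).congr_deriv ?_
    have hphi : PhiInv M α * kernelMoment M 1 (PhiInv M α) = α := by
      rw [← Phi_eq, Phi_PhiInv hM hα]
    have h0 := (kernelMoment_pos hM 1 (PhiInv_pos hM hα)).ne'
    nth_rw 2 [← hphi]
    rw [Real.log_mul (PhiInv_pos hM hα).ne' h0]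
    ring
  refine StrictAntiOn.strictConcaveOn_of_deriv (convex_Ioo _ _)
    (fun α hα => (hd α hα).continuousAt.continuousWithinAt) ?_
  rw [interior_Ioo]
  intro α hα β hβ h
  rw [(hd α hα).deriv, (hd β hβ).deriv]
  have h1 := kernelMoment_one_strictAntiOn hM (PhiInv_pos hM hα) (PhiInv_pos hM hβ)
    (strictMonoOn_PhiInv hM hα hβ h)
  have h2 := kernelMoment_pos hM 1 (PhiInv_pos hM hβ)
  linarith [Real.log_lt_log h2 h1]

end Nondegenerate

end Kernel

/-! ### Asymptotics of the row probabilities along a filter on which the empirical measures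
converge. -/

/-- The integrals of continuous functions with respect to the empirical measures of the rows of `p`
converge along `l` to the integrals with respect to `M`. -/
def EmpiricalTendsto (p : (n : ℕ) → Fin n → I) (l : Filter ℕ) (M : ProbabilityMeasure I) : Prop :=
  ∀ f : I → ℝ, Continuous f →
    Tendsto (fun n : ℕ => (∑ k, f (p n k)) / (n : ℝ)) l (𝓝 (∫ y, f y ∂(M : Measure I)))

/-- The probability that the sum of the `n`-th row equals `k`. -/
noncomputable def rowCoeff (p : (n : ℕ) → Fin n → I) (n k : ℕ) : ℝ :=
  (genPoly Finset.univ (p n)).coeff k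

theorem rowCoeff_nonneg (p : (n : ℕ) → Fin n → I) (n k : ℕ) : 0 ≤ rowCoeff p n k :=
  coeff_genPoly_nonneg _ _ _

theorem eval_genPoly_pos {ι : Type*} (s : Finset ι) (q : ι → I) {t : ℝ} (ht : 0 < t) :
    0 < (genPoly s q).eval t := by
  rw [eval_genPoly]
  exact Finset.prod_pos fun i _ => den_pos ht (q i)

theorem tendsto_log_add_one_div {l : Filter ℕ} (hl : l ≤ atTop) :
    Tendsto (fun n : ℕ => Real.log ((n : ℝ) + 1) / n) l (𝓝 0) := by
  have h1 : Tendsto (fun x : ℝ => Real.log x / x) atTop (𝓝 0) :=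
    Real.isLittleO_log_id_atTop.tendsto_div_nhds_zero
  have h2 : Tendsto (fun n : ℕ => (n : ℝ) + 1) atTop atTop :=
    tendsto_atTop_add_const_right _ _ tendsto_natCast_atTop_atTop
  have h3 : Tendsto (fun n : ℕ => ((n : ℝ) + 1) / n) atTop (𝓝 1) := by
    have : Tendsto (fun n : ℕ => 1 + 1 / (n : ℝ)) atTop (𝓝 (1 + 0)) :=
      tendsto_const_nhds.add tendsto_one_div_atTop_nhds_zero_nat
    rw [add_zero] at this
    refine this.congr' ?_
    filter_upwards [eventually_gt_atTop 0] with n hn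
    have : (n : ℝ) ≠ 0 := by positivity
    field_simp
  have h4 := (h1.comp h2).mul h3
  rw [zero_mul] at h4
  refine (h4.congr' ?_).mono_left hl
  filter_upwards with n
  have : (n : ℝ) + 1 ≠ 0 := by positivity
  simp only [Function.comp]
  field_simp

theorem tendsto_add_one_div {l : Filter ℕ} (hl : l ≤ atTop) {k : ℕ → ℕ} {α : ℝ}
    (hk : Tendsto (fun n => (k n : ℝ) / n) l (𝓝 α)) :
    Tendsto (fun n => ((k n + 1 : ℕ) : ℝ) / n) l (𝓝 α) := by
  have h := hk.add (tendsto_one_div_atTop_nhds_zero_nat.mono_left hl)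
  rw [add_zero] at h
  refine h.congr fun n => ?_
  push_cast
  ring

theorem tendsto_sub_one_div {l : Filter ℕ} (hl : l ≤ atTop) {k : ℕ → ℕ} {α : ℝ}
    (hk : Tendsto (fun n => (k n : ℝ) / n) l (𝓝 α)) (hpos : ∀ᶠ n in l, 0 < k n) :
    Tendsto (fun n => ((k n - 1 : ℕ) : ℝ) / n) l (𝓝 α) := by
  have h := hk.sub (tendsto_one_div_atTop_nhds_zero_nat.mono_left hl)
  rw [sub_zero] at h
  refine h.congr' ?_
  filter_upwards [hpos] with n hn
  rw [Nat.cast_sub hn]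
  push_cast
  ring

section Asymptotics

variable {p : (n : ℕ) → Fin n → I} {l : Filter ℕ} {M : ProbabilityMeasure I}

theorem EmpiricalTendsto.tendsto_log_eval (h : EmpiricalTendsto p l M) {t : ℝ} (ht : 0 < t) :
    Tendsto (fun n : ℕ => Real.log ((genPoly Finset.univ (p n)).eval t) / n) l
      (𝓝 (Psi M t)) := by
  refine (h _ (continuous_log_den ht)).congr fun n => ?_
  rw [eval_genPoly, Real.log_prod fun i _ => (den_pos ht (p n i)).ne']

/-- This is the normalised logarithmic gap between the two sides of `eval_genPoly_le_of_ratio_le`; a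
positive limit refutes that inequality eventually. -/
theorem EmpiricalTendsto.tendsto_log_eval_sub (h : EmpiricalTendsto p l M) (hl : l ≤ atTop)
    {k : ℕ → ℕ} {α : ℝ} (hk : Tendsto (fun n => (k n : ℝ) / n) l (𝓝 α)) {t t' : ℝ}
    (ht : 0 < t) (ht' : 0 < t') :
    Tendsto (fun n : ℕ => (Real.log ((genPoly Finset.univ (p n)).eval t) -
      Real.log ((n + 1) * ((genPoly Finset.univ (p n)).eval t' * (t / t') ^ k n))) / n) l
      (𝓝 (Psi M t - (Psi M t' + α * Real.log (t / t')))) := by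
  have h1 := (h.tendsto_log_eval ht).sub ((h.tendsto_log_eval ht').add
    (hk.mul_const (Real.log (t / t'))))
  have h2 := h1.sub (tendsto_log_add_one_div hl)
  rw [sub_zero] at h2
  refine h2.congr fun n => ?_
  have e1 := (eval_genPoly_pos Finset.univ (p n) ht').ne'
  have e2 : (t / t') ^ k n ≠ 0 := by positivity
  have e3 : (n : ℝ) + 1 ≠ 0 := by positivity
  rw [Real.log_mul e3 (mul_ne_zero e1 e2), Real.log_mul e1 e2, Real.log_pow]
  ring

/-- Below `Φ(t)` the ratio of consecutive probabilities exceeds `1 / t`. -/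
theorem EmpiricalTendsto.eventually_lt_mul (h : EmpiricalTendsto p l M) (hl : l ≤ atTop)
    {k : ℕ → ℕ} {α : ℝ} (hk : Tendsto (fun n => (k n : ℝ) / n) l (𝓝 α)) {t : ℝ} (ht : 0 < t)
    (hα : α < Phi M t) :
    ∀ᶠ n in l, rowCoeff p n (k n) = 0 ∨ rowCoeff p n (k n) < rowCoeff p n (k n + 1) * t := by
  have hd := hasDerivAt_Psi_exp M (Real.log t)
  rw [Real.exp_log ht] at hd
  -- The slope at `log t` tends to `Φ(t) > α`, so some secant to the left still has slope above `α`;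
  -- its other end `e^u` is the comparison point.
  obtain ⟨u, hu, hut⟩ : ∃ u, α < slope (fun u => Psi M (Real.exp u)) (Real.log t) u ∧
      u < Real.log t :=
    ((((hasDerivAt_iff_tendsto_slope.1 hd).mono_left
      (nhdsWithin_mono _
        (show Iio (Real.log t) ⊆ {Real.log t}ᶜ from fun x hx => ne_of_lt hx))).eventually_const_lt hα).and
      (self_mem_nhdsWithin (s := Iio (Real.log t)))).exists
  have htu : Real.exp u < t := (Real.lt_log_iff_exp_lt ht).1 hut
  rw [slope_comm, slope_def_field, lt_div_iff₀ (sub_pos.2 hut), Real.exp_log ht] at hu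
  have key := h.tendsto_log_eval_sub hl hk ht (Real.exp_pos u)
  rw [Real.log_div ht.ne' (Real.exp_pos u).ne', Real.log_exp] at key
  have hpos : 0 < Psi M t - (Psi M (Real.exp u) + α * (Real.log t - u)) := by linarith
  filter_upwards [key.eventually_const_lt hpos, hl (eventually_gt_atTop 0)] with n hn hn0
  by_contra hcon
  rw [not_or, not_lt] at hcon
  have hle := eval_genPoly_le_of_ratio_le (s := Finset.univ) (q := p n) (k := k n)
    (Real.exp_pos u) htu.le (lt_of_le_of_ne (rowCoeff_nonneg p n (k n)) (Ne.symm hcon.1)) hcon.2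
  rw [Finset.card_univ, Fintype.card_fin] at hle
  have hlog := Real.log_le_log (eval_genPoly_pos Finset.univ (p n) ht) hle
  have hn0' : (0 : ℝ) < n := Nat.cast_pos.2 hn0
  rw [lt_div_iff₀ hn0', zero_mul] at hn
  linarith

/-- Above `Φ(t)` the ratio of consecutive probabilities is below `1 / t`. -/
theorem EmpiricalTendsto.eventually_mul_lt (h : EmpiricalTendsto p l M) (hl : l ≤ atTop)
    {k : ℕ → ℕ} {α : ℝ} (hk : Tendsto (fun n => (k n : ℝ) / n) l (𝓝 α)) {t : ℝ} (ht : 0 < t)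
    (hα : Phi M t < α) :
    ∀ᶠ n in l, rowCoeff p n (k n + 1) = 0 ∨
      rowCoeff p n (k n + 1) * t < rowCoeff p n (k n) := by
  have hd := hasDerivAt_Psi_exp M (Real.log t)
  rw [Real.exp_log ht] at hd
  obtain ⟨u, hu, hut⟩ : ∃ u, slope (fun u => Psi M (Real.exp u)) (Real.log t) u < α ∧
      Real.log t < u :=
    ((((hasDerivAt_iff_tendsto_slope.1 hd).mono_left
      (nhdsWithin_mono _
        (show Ioi (Real.log t) ⊆ {Real.log t}ᶜ from fun x hx => ne_of_gt hx))).eventually_lt_const hα).and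
      (self_mem_nhdsWithin (s := Ioi (Real.log t)))).exists
  have htu : t < Real.exp u := (Real.log_lt_iff_lt_exp ht).1 hut
  rw [slope_def_field, div_lt_iff₀ (sub_pos.2 hut), Real.exp_log ht] at hu
  -- The mirror bound carries the exponent `k + 1`, which leaves the limit `α` unchanged.
  have key := h.tendsto_log_eval_sub hl (tendsto_add_one_div hl hk) ht (Real.exp_pos u)
  rw [Real.log_div ht.ne' (Real.exp_pos u).ne', Real.log_exp] at key
  have hpos : 0 < Psi M t - (Psi M (Real.exp u) + α * (Real.log t - u)) := by linarith
  filter_upwards [key.eventually_const_lt hpos, hl (eventually_gt_atTop 0)] with n hn hn0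
  by_contra hcon
  rw [not_or, not_lt] at hcon
  have hle := eval_genPoly_le_of_le_ratio (s := Finset.univ) (q := p n) (k := k n) ht htu.le
    (lt_of_le_of_ne (rowCoeff_nonneg p n (k n + 1)) (Ne.symm hcon.1)) hcon.2
  rw [Finset.card_univ, Fintype.card_fin] at hle
  have hlog := Real.log_le_log (eval_genPoly_pos Finset.univ (p n) ht) hle
  have hn0' : (0 : ℝ) < n := Nat.cast_pos.2 hn0
  rw [lt_div_iff₀ hn0', zero_mul] at hn
  linarith

/-- The integrand of `Φ` dominates the indicator of `{1}`. Being continuous, it controls the number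
of unit parameters through weak convergence, which does not apply to the indicator itself. -/
theorem card_one_le_sum {ι : Type*} (s : Finset ι) (q : ι → I) {t : ℝ} (ht : 0 < t) :
    ((s.filter fun i => q i = 1).card : ℝ) ≤
      ∑ i ∈ s, t * ((q i : ℝ) / (1 - (q i : ℝ) + q i * t)) := by
  rw [Finset.card_filter, Nat.cast_sum]
  refine Finset.sum_le_sum fun i _ => ?_
  split_ifs with h
  · simp [h, ht.ne']
  · simpa using mul_nonneg ht.le (div_den_nonneg ht (q i))

theorem sum_add_card_zero_le {ι : Type*} (s : Finset ι) (q : ι → I) {t : ℝ} (ht : 0 < t) :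
    ∑ i ∈ s, t * ((q i : ℝ) / (1 - (q i : ℝ) + q i * t)) +
      ((s.filter fun i => q i = 0).card : ℝ) ≤ s.card := by
  rw [Finset.card_filter, Nat.cast_sum, ← Finset.sum_add_distrib]
  refine (Finset.sum_le_card_nsmul s _ (1 : ℝ) fun i _ => ?_).trans (by simp)
  split_ifs with h
  · simp [h]
  · simpa using mul_div_den_le_one ht (q i)

theorem EmpiricalTendsto.tendsto_sum_Phi (h : EmpiricalTendsto p l M) {t : ℝ} (ht : 0 < t) :
    Tendsto (fun n : ℕ => (∑ i, t * ((p n i : ℝ) / (1 - (p n i : ℝ) + p n i * t))) / n) l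
      (𝓝 (Phi M t)) := by
  rw [Phi_eq_integral]
  exact h _ ((continuous_div_den ht).const_mul t)

theorem EmpiricalTendsto.eventually_card_one_le (h : EmpiricalTendsto p l M) (hl : l ≤ atTop)
    {k : ℕ → ℕ} {α : ℝ} (hk : Tendsto (fun n => (k n : ℝ) / n) l (𝓝 α))
    (hα : (M : Measure I).real {1} < α) :
    ∀ᶠ n in l, (Finset.univ.filter fun i => p n i = 1).card ≤ k n := by
  obtain ⟨t, htα, ht⟩ := (((tendsto_Phi_zero M).eventually_lt_const hα).and
    self_mem_nhdsWithin).exists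
  filter_upwards [(h.tendsto_sum_Phi ht).eventually_lt hk htα, hl (eventually_gt_atTop 0)]
    with n hn hn0
  rw [div_lt_div_iff_of_pos_right (Nat.cast_pos.2 hn0)] at hn
  exact_mod_cast (card_one_le_sum Finset.univ (p n) ht).trans hn.le

theorem EmpiricalTendsto.eventually_add_card_zero_le (h : EmpiricalTendsto p l M)
    (hl : l ≤ atTop) {k : ℕ → ℕ} {α : ℝ} (hk : Tendsto (fun n => (k n : ℝ) / n) l (𝓝 α))
    (hα : α < 1 - (M : Measure I).real {0}) :
    ∀ᶠ n in l, k n + (Finset.univ.filter fun i => p n i = 0).card ≤ n := by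
  obtain ⟨t, htα, ht⟩ := (((tendsto_Phi_atTop M).eventually_const_lt hα).and
    (eventually_gt_atTop 0)).exists
  filter_upwards [hk.eventually_lt (h.tendsto_sum_Phi ht) htα, hl (eventually_gt_atTop 0)]
    with n hn hn0
  rw [div_lt_div_iff_of_pos_right (Nat.cast_pos.2 hn0)] at hn
  have h1 := sum_add_card_zero_le Finset.univ (p n) ht
  rw [Finset.card_univ, Fintype.card_fin] at h1
  have h2 : (k n : ℝ) + ((Finset.univ.filter fun i => p n i = 0).card : ℝ) ≤ n := by linarith
  exact_mod_cast h2

theorem rowCoeff_pos_iff (p : (n : ℕ) → Fin n → I) (n k : ℕ) :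
    0 < rowCoeff p n k ↔ (Finset.univ.filter fun i => p n i = 1).card ≤ k ∧
      k + (Finset.univ.filter fun i => p n i = 0).card ≤ n := by
  rw [(rowCoeff_nonneg p n k).lt_iff_ne', rowCoeff, coeff_genPoly_ne_zero_iff, Finset.card_univ,
    Fintype.card_fin]

theorem EmpiricalTendsto.eventually_pos (h : EmpiricalTendsto p l M) (hl : l ≤ atTop)
    {k : ℕ → ℕ} {α : ℝ} (hk : Tendsto (fun n => (k n : ℝ) / n) l (𝓝 α))
    (hα : α ∈ Ioo ((M : Measure I).real {1}) (1 - (M : Measure I).real {0})) :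
    ∀ᶠ n in l, 0 < rowCoeff p n (k n) := by
  filter_upwards [h.eventually_card_one_le hl hk hα.1, h.eventually_add_card_zero_le hl hk hα.2]
    with n h1 h2
  exact (rowCoeff_pos_iff p n (k n)).2 ⟨h1, h2⟩

/-- Chernoff bound. -/
theorem log_rowCoeff_le (p : (n : ℕ) → Fin n → I) {n k : ℕ} (hc : 0 < rowCoeff p n k) {t : ℝ}
    (ht : 0 < t) :
    Real.log (rowCoeff p n k) / n ≤
      Real.log ((genPoly Finset.univ (p n)).eval t) / n - (k : ℝ) / n * Real.log t := by
  have h1 := Real.log_le_log (mul_pos hc (pow_pos ht k))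
    (coeff_genPoly_mul_pow_le Finset.univ (p n) k ht.le)
  rw [Real.log_mul hc.ne' (pow_pos ht k).ne', Real.log_pow] at h1
  rw [div_mul_eq_mul_div, ← sub_div]
  exact div_le_div_of_nonneg_right (by linarith) (Nat.cast_nonneg n)

/-- Converse of the Chernoff bound. Terms below the index `k + 1` are compared under the tilt `t₂`,
terms above it under `t₁`, so every `a_j t₁^j` is at most `a_{k+1} t₂^(k+1)`. -/
theorem le_log_rowCoeff {p : (n : ℕ) → Fin n → I} {n k : ℕ} (hc : 0 < rowCoeff p n (k + 1))
    {t₁ t₂ : ℝ} (ht₁ : 0 < t₁) (ht : t₁ ≤ t₂)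
    (h₁ : rowCoeff p n (k + 2) * t₁ ≤ rowCoeff p n (k + 1))
    (h₂ : rowCoeff p n k ≤ rowCoeff p n (k + 1) * t₂) :
    Real.log ((genPoly Finset.univ (p n)).eval t₁) / n - ((k + 1 : ℕ) : ℝ) / n * Real.log t₂ -
      Real.log ((n : ℝ) + 1) / n ≤ Real.log (rowCoeff p n (k + 1)) / n := by
  have ht₂ : 0 < t₂ := ht₁.trans_le ht
  have hle : (genPoly Finset.univ (p n)).eval t₁ ≤
      ((Finset.univ : Finset (Fin n)).card + 1) * (rowCoeff p n (k + 1) * t₂ ^ (k + 1)) := by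
    refine eval_genPoly_le_of_forall_le fun j => ?_
    have hj : ∀ j, t₁ ^ j ≤ t₂ ^ j := fun j => pow_le_pow_left₀ ht₁.le ht j
    rcases le_total j (k + 1) with hjk | hjk
    · exact (mul_le_mul_of_nonneg_left (hj j) (coeff_genPoly_nonneg _ _ _)).trans
        (coeff_genPoly_mul_pow_le_of_le ht₂.le hc h₂ hjk)
    · exact (coeff_genPoly_mul_pow_le_of_ge ht₁.le hc h₁ hjk).trans
        (mul_le_mul_of_nonneg_left (hj _) hc.le)
  rw [Finset.card_univ, Fintype.card_fin] at hle
  have hlog := Real.log_le_log (eval_genPoly_pos Finset.univ (p n) ht₁) hle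
  rw [Real.log_mul (by positivity) (by positivity), Real.log_mul hc.ne' (by positivity),
    Real.log_pow] at hlog
  rw [div_mul_eq_mul_div, ← sub_div, ← sub_div]
  exact div_le_div_of_nonneg_right (by linarith) (Nat.cast_nonneg n)

section Nondegenerate

variable (hM : (M : Measure I).real {1} < 1 - (M : Measure I).real {0})
include hM

theorem EmpiricalTendsto.tendsto_log_rowCoeff (h : EmpiricalTendsto p l M) (hl : l ≤ atTop)
    {k : ℕ → ℕ} {α : ℝ} (hk : Tendsto (fun n => (k n : ℝ) / n) l (𝓝 α))
    (hα : α ∈ Ioo ((M : Measure I).real {1}) (1 - (M : Measure I).real {0})) :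
    Tendsto (fun n => Real.log (rowCoeff p n (k n)) / n) l
      (𝓝 (Psi M (PhiInv M α) - α * Real.log (PhiInv M α))) := by
  have ht := PhiInv_pos hM hα
  have hΦ := Phi_PhiInv hM hα
  set t := PhiInv M α
  have hα0 : 0 < α := measureReal_nonneg.trans_lt hα.1
  have hk0 : ∀ᶠ n in l, 0 < k n := by
    filter_upwards [hk.eventually_const_lt hα0] with n hn
    refine Nat.pos_of_ne_zero fun h0 => ?_
    simp [h0] at hn
  have hcpos := h.eventually_pos hl hk hα
  have hcpos' := h.eventually_pos hl (tendsto_sub_one_div hl hk hk0) hα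
  have hcpos'' := h.eventually_pos hl (tendsto_add_one_div hl hk) hα
  refine tendsto_order.2 ⟨fun b hb => ?_, fun b hb => ?_⟩
  -- Strict inequalities for `Φ` are needed on both sides of `α`, so `t` is replaced by `t₁ < t <
  -- t₂`; continuity keeps the loss small enough to stay above `b`.
  · obtain ⟨t₁, hb₁, ht₁, ht₁'⟩ : ∃ t₁, b < Psi M t₁ - α * Real.log t ∧ 0 < t₁ ∧ t₁ < t := by
      have hc : ContinuousAt (fun s => Psi M s - α * Real.log t) t :=
        (hasDerivAt_Psi M ht).continuousAt.sub continuousAt_const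
      exact (((hc.tendsto.mono_left nhdsWithin_le_nhds).eventually_const_lt hb).and
        (Ioo_mem_nhdsLT ht)).exists
    obtain ⟨t₂, hb₂, ht₂⟩ : ∃ t₂, b < Psi M t₁ - α * Real.log t₂ ∧ t < t₂ := by
      have hc : ContinuousAt (fun s => Psi M t₁ - α * Real.log s) t :=
        continuousAt_const.sub (continuousAt_const.mul (Real.continuousAt_log ht.ne'))
      exact (((hc.tendsto.mono_left nhdsWithin_le_nhds).eventually_const_lt hb₁).and
        (self_mem_nhdsWithin (s := Ioi t))).exists
    have hΦ₁ : Phi M t₁ < α := hΦ ▸ strictMonoOn_Phi hM ht₁ ht ht₁'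
    have hΦ₂ : α < Phi M t₂ := hΦ ▸ strictMonoOn_Phi hM ht (ht.trans ht₂) ht₂
    have hlim := ((h.tendsto_log_eval ht₁).sub (hk.mul_const (Real.log t₂))).sub
      (tendsto_log_add_one_div hl)
    rw [sub_zero] at hlim
    filter_upwards [hlim.eventually_const_lt hb₂, hk0, hcpos, hcpos', hcpos'',
      h.eventually_mul_lt hl hk ht₁ hΦ₁,
      h.eventually_lt_mul hl (tendsto_sub_one_div hl hk hk0) (ht.trans ht₂) hΦ₂]
      with n hn hkn hc hc' hc'' h1 h2
    obtain ⟨j, hj⟩ : ∃ j, k n = j + 1 := ⟨k n - 1, by omega⟩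
    rw [hj, Nat.add_sub_cancel] at h2 hc'
    rw [hj] at hn h1 hc hc'' ⊢
    exact hn.trans_le (le_log_rowCoeff hc ht₁ (ht₁'.trans ht₂).le
      (h1.resolve_left hc''.ne').le (h2.resolve_left hc'.ne').le)
  · have hlim := (h.tendsto_log_eval ht).sub (hk.mul_const (Real.log t))
    filter_upwards [hlim.eventually_lt_const hb, hcpos] with n hn hc
    exact (log_rowCoeff_le p hc ht).trans_lt hn

theorem EmpiricalTendsto.tendsto_ratio (h : EmpiricalTendsto p l M) (hl : l ≤ atTop)
    {k : ℕ → ℕ} {α : ℝ} (hk : Tendsto (fun n => (k n : ℝ) / n) l (𝓝 α))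
    (hα : α ∈ Ioo ((M : Measure I).real {1}) (1 - (M : Measure I).real {0})) :
    Tendsto (fun n => rowCoeff p n (k n + 1) / rowCoeff p n (k n)) l (𝓝 (PhiInv M α)⁻¹) := by
  have ht := PhiInv_pos hM hα
  have hΦ := Phi_PhiInv hM hα
  set t := PhiInv M α
  have hcpos := h.eventually_pos hl hk hα
  have hcpos'' := h.eventually_pos hl (tendsto_add_one_div hl hk) hα
  have hc : ContinuousAt (fun s : ℝ => s⁻¹) t := continuousAt_inv₀ ht.ne'
  refine tendsto_order.2 ⟨fun b hb => ?_, fun b hb => ?_⟩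
  · obtain ⟨t₂, hb₂, ht₂⟩ : ∃ t₂, b < t₂⁻¹ ∧ t < t₂ :=
      (((hc.tendsto.mono_left nhdsWithin_le_nhds).eventually_const_lt hb).and
        (self_mem_nhdsWithin (s := Ioi t))).exists
    have hΦ₂ : α < Phi M t₂ := hΦ ▸ strictMonoOn_Phi hM ht (ht.trans ht₂) ht₂
    filter_upwards [hcpos, h.eventually_lt_mul hl hk (ht.trans ht₂) hΦ₂] with n hc h1
    refine hb₂.trans ?_
    rw [lt_div_iff₀ hc, inv_mul_lt_iff₀ (ht.trans ht₂), mul_comm]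
    exact h1.resolve_left hc.ne'
  · obtain ⟨t₁, hb₁, ht₁, ht₁'⟩ : ∃ t₁, t₁⁻¹ < b ∧ 0 < t₁ ∧ t₁ < t :=
      (((hc.tendsto.mono_left nhdsWithin_le_nhds).eventually_lt_const hb).and
        (Ioo_mem_nhdsLT ht)).exists
    have hΦ₁ : Phi M t₁ < α := hΦ ▸ strictMonoOn_Phi hM ht₁ ht ht₁'
    filter_upwards [hcpos, hcpos'', h.eventually_mul_lt hl hk ht₁ hΦ₁] with n hc hc'' h1
    refine lt_trans ?_ hb₁
    rw [div_lt_iff₀ hc, lt_inv_mul_iff₀ ht₁, mul_comm]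
    exact h1.resolve_left hc''.ne'

end Nondegenerate

/-- Outside the closed interval the Chernoff exponent `Ψ(e^u) - α u` is unbounded below: let `u →
-∞` on the left and `u → ∞` on the right. -/
theorem EmpiricalTendsto.eventually_log_rowCoeff_lt (h : EmpiricalTendsto p l M)
    {k : ℕ → ℕ} {α : ℝ} (hk : Tendsto (fun n => (k n : ℝ) / n) l (𝓝 α))
    (hα : α < (M : Measure I).real {1} ∨ 1 - (M : Measure I).real {0} < α) (x : ℝ) :
    ∀ᶠ n in l, rowCoeff p n (k n) = 0 ∨ Real.log (rowCoeff p n (k n)) / n < x := by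
  obtain ⟨u, hu⟩ : ∃ u : ℝ, Psi M (Real.exp u) - α * u < x := by
    rcases hα with hα | hα
    · have hd : 0 < (M : Measure I).real {1} - α := sub_pos.2 hα
      -- Chosen so that `u * (M{1} - α) ≤ x - 1` while `u ≤ 0`, as the bound on `Ψ(e^u)` requires.
      refine ⟨min 0 ((x - 1) / ((M : Measure I).real {1} - α)), ?_⟩
      have h1 := Psi_exp_le_of_nonpos M (min_le_left 0 ((x - 1) / ((M : Measure I).real {1} - α)))
      have h2 := (le_div_iff₀ hd).1 (min_le_right 0 ((x - 1) / ((M : Measure I).real {1} - α)))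
      linarith
    · have hd : 0 < α - (1 - (M : Measure I).real {0}) := sub_pos.2 hα
      refine ⟨max 0 ((1 - x) / (α - (1 - (M : Measure I).real {0}))), ?_⟩
      have h1 := Psi_exp_le_of_nonneg M
        (le_max_left 0 ((1 - x) / (α - (1 - (M : Measure I).real {0}))))
      have h2 := (div_le_iff₀ hd).1
        (le_max_right 0 ((1 - x) / (α - (1 - (M : Measure I).real {0}))))
      linarith
  have hlim := (h.tendsto_log_eval (Real.exp_pos u)).sub
    (hk.mul_const (Real.log (Real.exp u)))
  rw [Real.log_exp] at hlim
  filter_upwards [hlim.eventually_lt_const hu] with n hn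
  rcases (rowCoeff_nonneg p n (k n)).eq_or_lt with h0 | h0
  · exact Or.inl h0.symm
  · refine Or.inr ((log_rowCoeff_le p h0 (Real.exp_pos u)).trans_lt ?_)
    rwa [Real.log_exp]

end Asymptotics

/-! ### From convergent sequences to uniform statements. -/

/-- A statement that holds along all ultrafilters for convergent sequences `k n / n` holds
uniformly. -/
theorem eventually_forall_of_ultrafilter {A Q : ℕ → ℕ → Prop}
    (hA : ∀ᶠ n in atTop, ∀ k, A n k → k ≤ n)
    (h : ∀ (U : Ultrafilter ℕ) (k : ℕ → ℕ) (α : ℝ), (U : Filter ℕ) ≤ atTop →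
      (∀ᶠ n in (U : Filter ℕ), A n (k n)) →
      Tendsto (fun n => (k n : ℝ) / n) U (𝓝 α) → ∀ᶠ n in (U : Filter ℕ), Q n (k n)) :
    ∀ᶠ n in atTop, ∀ k, A n k → Q n k := by
  by_contra hcon
  have hfr : ∃ᶠ n in atTop, ∃ k, A n k ∧ ¬ Q n k := by
    refine (not_eventually.1 hcon).mono fun n hn => ?_
    push Not at hn
    exact hn
  have hk : ∀ n, ∃ k, (∃ k, A n k ∧ ¬ Q n k) → A n k ∧ ¬ Q n k := by
    intro n
    by_cases hn : ∃ k, A n k ∧ ¬ Q n k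
    · exact ⟨hn.choose, fun _ => hn.choose_spec⟩
    · exact ⟨0, fun h => absurd h hn⟩
  choose k hk using hk
  -- The bad rows form a set met frequently, so an ultrafilter finer than `atTop` lives on them;
  -- there the selected `k n / n` converges by compactness of `[0,1]`.
  have : NeBot (atTop ⊓ 𝓟 {n | ∃ k, A n k ∧ ¬ Q n k}) := frequently_mem_iff_neBot.1 hfr
  set U := Ultrafilter.of (atTop ⊓ 𝓟 {n | ∃ k, A n k ∧ ¬ Q n k})
  have hU : (U : Filter ℕ) ≤ atTop ⊓ 𝓟 {n | ∃ k, A n k ∧ ¬ Q n k} := Ultrafilter.of_le _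
  have hUt : (U : Filter ℕ) ≤ atTop := hU.trans inf_le_left
  have hUk : ∀ᶠ n in (U : Filter ℕ), A n (k n) ∧ ¬ Q n (k n) := by
    have : {n | ∃ k, A n k ∧ ¬ Q n k} ∈ (U : Filter ℕ) :=
      (hU.trans inf_le_right) (mem_principal_self _)
    filter_upwards [this] with n hn using hk n hn
  have hIcc : ∀ᶠ n in (U : Filter ℕ), (k n : ℝ) / n ∈ Icc (0 : ℝ) 1 := by
    filter_upwards [hUk, hUt hA] with n hn hn'
    exact ⟨by positivity, div_le_one_of_le₀ (Nat.cast_le.2 (hn' _ hn.1)) (Nat.cast_nonneg n)⟩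
  obtain ⟨α, -, hα⟩ := isCompact_Icc.ultrafilter_le_nhds
    (U.map fun n => (k n : ℝ) / n) (le_principal_iff.2 hIcc)
  obtain ⟨n, hn, hn'⟩ := ((h U k α hUt (hUk.mono fun n hn => hn.1) hα).and hUk).exists
  exact hn'.2 hn

/-! ### Empirical measures and their compactness. -/

section EmpiricalMeasure

theorem toMeasure_empiricalMeasure (p : (n : ℕ) → Fin n → I) (n : ℕ) :
    (empiricalMeasure p n : Measure I) = (n : ℝ≥0)⁻¹ • ∑ k : Fin n, Measure.dirac (p n k) := by
  rw [empiricalMeasure, FiniteMeasure.toMeasure_smul, FiniteMeasure.toMeasure_sum]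
  rfl

theorem integral_empiricalMeasure (p : (n : ℕ) → Fin n → I) (n : ℕ) (f : I → ℝ) :
    ∫ y, f y ∂(empiricalMeasure p n : Measure I) = (∑ k, f (p n k)) / n := by
  rw [toMeasure_empiricalMeasure, integral_smul_nnreal_measure, integral_finsetSum_measure]
  · simp only [integral_dirac, NNReal.smul_def, NNReal.coe_inv, NNReal.coe_natCast, smul_eq_mul]
    ring
  · exact fun i _ => integrable_dirac (by simp)

theorem isProbabilityMeasure_empiricalMeasure (p : (n : ℕ) → Fin n → I) {n : ℕ} (hn : 0 < n) :
    IsProbabilityMeasure (empiricalMeasure p n : Measure I) := by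
  refine ⟨?_⟩
  rw [toMeasure_empiricalMeasure, Measure.smul_apply, Measure.finsetSum_apply]
  have h : (n : ℝ≥0) ≠ 0 := by positivity
  simp only [measure_univ, Finset.sum_const, Finset.card_univ, Fintype.card_fin, nsmul_eq_mul,
    mul_one]
  rw [ENNReal.smul_def, smul_eq_mul, ENNReal.coe_inv h, ENNReal.coe_natCast]
  exact ENNReal.inv_mul_cancel (by positivity) (ENNReal.natCast_ne_top n)

theorem EmpiricalTendsto.tendsto_empiricalMeasure {p : (n : ℕ) → Fin n → I} {l : Filter ℕ}
    {M : ProbabilityMeasure I} (h : EmpiricalTendsto p l M) :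
    Tendsto (fun n => empiricalMeasure p n) l (𝓝 M.toFiniteMeasure) := by
  rw [FiniteMeasure.tendsto_iff_forall_integral_tendsto]
  intro f
  simp only [integral_empiricalMeasure]
  exact h f f.continuous

/-- Compactness: the empirical measures converge along every ultrafilter. -/
theorem exists_empiricalTendsto (p : (n : ℕ) → Fin n → I) (U : Ultrafilter ℕ)
    (hU : (U : Filter ℕ) ≤ atTop) : ∃ M : ProbabilityMeasure I, EmpiricalTendsto p U M := by
  classical
  -- The row `n = 0` has zero empirical measure, so an arbitrary point mass stands in for it.
  let ν : ℕ → ProbabilityMeasure I := fun n =>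
    if hn : 0 < n then ⟨_, isProbabilityMeasure_empiricalMeasure p hn⟩ else diracProba 0
  obtain ⟨M, -, hM⟩ := (isCompact_univ (X := ProbabilityMeasure I)).ultrafilter_le_nhds (U.map ν)
    (by simp)
  refine ⟨M, fun f hf => ?_⟩
  have h := ProbabilityMeasure.tendsto_iff_forall_integral_tendsto.1
    (show Tendsto ν U (𝓝 M) from hM) (BoundedContinuousFunction.mkOfCompact ⟨f, hf⟩)
  refine h.congr' ?_
  filter_upwards [hU (eventually_gt_atTop 0)] with n hn
  rw [← integral_empiricalMeasure]
  have hν : (ν n : Measure I) = (empiricalMeasure p n : Measure I) := by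
    rw [show ν n = _ from dif_pos hn]
    rfl
  rw [hν]
  rfl

end EmpiricalMeasure

theorem contDiffOn_rate {M : ProbabilityMeasure I}
    (hM : (M : Measure I).real {1} < 1 - (M : Measure I).real {0}) :
    ContDiffOn ℝ ((⊤ : ℕ∞) : WithTop ℕ∞)
      (fun α => Psi M (PhiInv M α) - α * Real.log (PhiInv M α))
      (Ioo ((M : Measure I).real {1}) (1 - (M : Measure I).real {0})) := by
  rw [contDiffOn_infty_iff_deriv_of_isOpen isOpen_Ioo]
  refine ⟨fun α hα => (hasDerivAt_rate hM hα).differentiableAt.differentiableWithinAt, ?_⟩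
  refine (((contDiffOn_infty.2 (contDiffOn_PhiInv hM)).log fun α hα =>
    (PhiInv_pos hM hα).ne').neg).congr fun α hα => ?_
  exact (hasDerivAt_rate hM hα).deriv

/-! ### Extended-valued rates and identification of the limit measure. -/

section LogRate

theorem tendsto_floor_mul_div {α : ℝ} (hα : 0 ≤ α) {l : Filter ℕ} (hl : l ≤ atTop) :
    Tendsto (fun n : ℕ => ((⌊α * n⌋₊ : ℕ) : ℝ) / n) l (𝓝 α) :=
  ((tendsto_nat_floor_mul_div_atTop hα).comp tendsto_natCast_atTop_atTop).mono_left hl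

variable {Ω : Type*} [MeasurableSpace Ω] {P : Measure Ω} {p : (n : ℕ) → Fin n → I}
  {B : (n : ℕ) → Fin n → Ω → ℕ} (hP : ∀ n k, probSum P B n k = ENNReal.ofReal (rowCoeff p n k))
include hP

theorem logRate_of_pos {n k : ℕ} (hc : 0 < rowCoeff p n k) :
    logRate P B n k = ((Real.log (rowCoeff p n k) / n : ℝ) : EReal) := by
  rw [logRate, hP, ENNReal.log_ofReal_of_pos hc, EReal.coe_div, EReal.coe_natCast]

theorem logRate_of_eq_zero {n k : ℕ} (hn : 0 < n) (hc : rowCoeff p n k = 0) :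
    logRate P B n k = ⊥ := by
  rw [logRate, hP, hc, ENNReal.ofReal_zero, ENNReal.log_zero]
  exact EReal.bot_div_of_pos_ne_top (by exact_mod_cast hn) (EReal.natCast_ne_top n)

theorem probSum_div {n k j : ℕ} (hc : 0 < rowCoeff p n k) :
    probSum P B n j / probSum P B n k = ENNReal.ofReal (rowCoeff p n j / rowCoeff p n k) := by
  rw [hP, hP, ENNReal.ofReal_div_of_pos hc]

theorem tendsto_logRate_bot {l : Filter ℕ} (hl : l ≤ atTop) {M : ProbabilityMeasure I}
    (h : EmpiricalTendsto p l M)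
    {k : ℕ → ℕ} {α : ℝ} (hk : Tendsto (fun n => (k n : ℝ) / n) l (𝓝 α))
    (hα : α < (M : Measure I).real {1} ∨ 1 - (M : Measure I).real {0} < α) :
    Tendsto (fun n => logRate P B n (k n)) l (𝓝 ⊥) := by
  rw [EReal.tendsto_nhds_bot_iff_real]
  intro x
  filter_upwards [h.eventually_log_rowCoeff_lt hk hα x, hl (eventually_gt_atTop 0)] with n hn hn0
  rcases (rowCoeff_nonneg p n (k n)).eq_or_lt with h0 | h0
  · rw [logRate_of_eq_zero hP hn0 h0.symm]
    exact EReal.bot_lt_coe x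
  · rw [logRate_of_pos hP h0]
    exact EReal.coe_lt_coe (hn.resolve_left h0.ne')

theorem tendsto_logRate {l : Filter ℕ} (hl : l ≤ atTop) {M : ProbabilityMeasure I}
    (h : EmpiricalTendsto p l M)
    (hM : (M : Measure I).real {1} < 1 - (M : Measure I).real {0})
    {k : ℕ → ℕ} {α : ℝ} (hk : Tendsto (fun n => (k n : ℝ) / n) l (𝓝 α))
    (hα : α ∈ Ioo ((M : Measure I).real {1}) (1 - (M : Measure I).real {0})) :
    Tendsto (fun n => logRate P B n (k n)) l
      (𝓝 ((Psi M (PhiInv M α) - α * Real.log (PhiInv M α) : ℝ) : EReal)) := by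
  refine ((continuous_coe_real_ereal.tendsto _).comp
    (h.tendsto_log_rowCoeff hM hl hk hα)).congr' ?_
  filter_upwards [h.eventually_pos hl hk hα] with n hn
  exact (logRate_of_pos hP hn).symm

/-- The limits of the logarithmic rates determine the atoms of every limit point of the empirical
measures and its rate function. -/
theorem atoms_and_rate_of_tendsto {mlo mhi : ℝ} (hmlo : 0 ≤ mlo) (hmlt : mlo < mhi)
    {g : ℝ → ℝ}
    (hinside : ∀ α ∈ Ioo mlo mhi,
      Tendsto (fun n : ℕ => logRate P B n ⌊α * n⌋₊) atTop (𝓝 (g α : EReal)))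
    (houtside : ∀ α ∈ Ico 0 mlo ∪ Ioc mhi 1,
      Tendsto (fun n : ℕ => logRate P B n ⌊α * n⌋₊) atTop (𝓝 (⊥ : EReal)))
    {l : Filter ℕ} [NeBot l] (hl : l ≤ atTop) {M : ProbabilityMeasure I}
    (h : EmpiricalTendsto p l M) :
    (M : Measure I).real {1} = mlo ∧ 1 - (M : Measure I).real {0} = mhi ∧
      ∀ α ∈ Ioo mlo mhi, g α = Psi M (PhiInv M α) - α * Real.log (PhiInv M α) := by
  have ha0 : 0 ≤ (M : Measure I).real {1} := measureReal_nonneg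
  have hb1 : 1 - (M : Measure I).real {0} ≤ 1 := by
    have : 0 ≤ (M : Measure I).real {0} := measureReal_nonneg
    linarith
  -- A finite rate at `α` excludes the value `-∞` that would hold outside the atom interval. This
  -- gives one inclusion of intervals and also nondegeneracy, which the reverse comparison with
  -- `houtside` needs.
  have hout : ∀ α ∈ Ioo mlo mhi,
      ¬ (α < (M : Measure I).real {1} ∨ 1 - (M : Measure I).real {0} < α) := fun α hα hcon =>
    EReal.coe_ne_bot (g α) (tendsto_nhds_unique ((hinside α hα).mono_left hl)
      (tendsto_logRate_bot hP hl h (tendsto_floor_mul_div (hmlo.trans hα.1.le) hl) hcon))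
  have ha : (M : Measure I).real {1} ≤ mlo := by
    by_contra! hcon
    obtain ⟨α, h1, h2⟩ := exists_between (lt_min hcon hmlt)
    exact hout α ⟨h1, h2.trans_le (min_le_right _ _)⟩ (Or.inl (h2.trans_le (min_le_left _ _)))
  have hb : mhi ≤ 1 - (M : Measure I).real {0} := by
    by_contra! hcon
    obtain ⟨α, h1, h2⟩ := exists_between (max_lt hcon hmlt)
    exact hout α ⟨(le_max_right _ _).trans_lt h1, h2⟩ (Or.inr ((le_max_left _ _).trans_lt h1))
  have hM : (M : Measure I).real {1} < 1 - (M : Measure I).real {0} :=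
    ha.trans_lt (hmlt.trans_le hb)
  have hin : ∀ α ∈ Ioo ((M : Measure I).real {1}) (1 - (M : Measure I).real {0}),
      Tendsto (fun n : ℕ => logRate P B n ⌊α * n⌋₊) l
        (𝓝 ((Psi M (PhiInv M α) - α * Real.log (PhiInv M α) : ℝ) : EReal)) := fun α hα =>
    tendsto_logRate hP hl h hM (tendsto_floor_mul_div (ha0.trans hα.1.le) hl) hα
  have ha' : mlo ≤ (M : Measure I).real {1} := by
    by_contra! hcon
    obtain ⟨α, h1, h2⟩ := exists_between hcon
    exact EReal.coe_ne_bot _ (tendsto_nhds_unique (hin α ⟨h1, h2.trans (hmlt.trans_le hb)⟩)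
      ((houtside α (Or.inl ⟨ha0.trans h1.le, h2⟩)).mono_left hl))
  have hb' : 1 - (M : Measure I).real {0} ≤ mhi := by
    by_contra! hcon
    obtain ⟨α, h1, h2⟩ := exists_between hcon
    exact EReal.coe_ne_bot _ (tendsto_nhds_unique (hin α ⟨(ha.trans_lt hmlt).trans h1, h2⟩)
      ((houtside α (Or.inr ⟨h1, h2.le.trans hb1⟩)).mono_left hl))
  refine ⟨le_antisymm ha ha', le_antisymm hb' hb, fun α hα => ?_⟩
  exact EReal.coe_injective (tendsto_nhds_unique ((hinside α hα).mono_left hl)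
    (hin α ⟨ha.trans_lt hα.1, hα.2.trans_le hb⟩))

end LogRate

/-- A probability measure is determined by its atoms at the endpoints and its rate function. -/
theorem eq_of_rate_eq {M N : ProbabilityMeasure I}
    (hM : (M : Measure I).real {1} < 1 - (M : Measure I).real {0})
    (h1 : (N : Measure I).real {1} = (M : Measure I).real {1})
    (h0 : 1 - (N : Measure I).real {0} = 1 - (M : Measure I).real {0})
    (h : ∀ α ∈ Ioo ((M : Measure I).real {1}) (1 - (M : Measure I).real {0}),
      Psi N (PhiInv N α) - α * Real.log (PhiInv N α) =
        Psi M (PhiInv M α) - α * Real.log (PhiInv M α)) : N = M := by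
  have hN : (N : Measure I).real {1} < 1 - (N : Measure I).real {0} := by rwa [h1, h0]
  have hinv : ∀ α ∈ Ioo ((M : Measure I).real {1}) (1 - (M : Measure I).real {0}),
      PhiInv N α = PhiInv M α := by
    intro α hα
    have hα' : α ∈ Ioo ((N : Measure I).real {1}) (1 - (N : Measure I).real {0}) := by
      rwa [h1, h0]
    -- The two rates agree on an open interval, so their derivatives `-log Φ←` agree, and with them
    -- the inverses.
    have hd := (hasDerivAt_rate hM hα).congr_of_eventuallyEq
      (eventually_of_mem (Ioo_mem_nhds hα.1 hα.2) h)
    have := neg_injective (hd.unique (hasDerivAt_rate hN hα'))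
    exact (Real.log_injOn_pos (PhiInv_pos hM hα) (PhiInv_pos hN hα') this).symm
  refine eq_of_Phi_eq fun t ht => ?_
  have hmem := (bijOn_Phi hM).mapsTo (show t ∈ Ioi 0 from ht)
  have h2 := hinv _ hmem
  rw [PhiInv_Phi hM ht] at h2
  rw [← h2, Phi_PhiInv hN (by rwa [h1, h0]), h2]

theorem rLower_eq (p : (n : ℕ) → Fin n → I) (n : ℕ) :
    rLower p n = (Finset.univ.filter fun i => p n i = 1).card := by
  rw [rLower, Nat.card_eq_fintype_card, Fintype.card_subtype]

theorem le_rUpper_iff (p : (n : ℕ) → Fin n → I) (n k : ℕ) :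
    k ≤ rUpper p n ↔ k + (Finset.univ.filter fun i => p n i = 0).card ≤ n := by
  rw [rUpper, Nat.card_eq_fintype_card, Fintype.card_subtype]
  refine Nat.le_sub_iff_add_le ((Finset.card_le_univ _).trans (by simp))

theorem rowCoeff_pos_iff_mem (p : (n : ℕ) → Fin n → I) (n k : ℕ) :
    0 < rowCoeff p n k ↔ rLower p n ≤ k ∧ k ≤ rUpper p n := by
  rw [rowCoeff_pos_iff, rLower_eq, le_rUpper_iff]

theorem eventually_abs_sub_le {l : Filter ℕ} {x : ℕ → EReal} {a b : ℕ → ℝ} {L : ℝ}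
    (hx : ∀ᶠ n in l, x n = (a n : EReal)) (ha : Tendsto a l (𝓝 L)) (hb : Tendsto b l (𝓝 L))
    {ε : ℝ≥0∞} (hε : 0 < ε) : ∀ᶠ n in l, EReal.abs (x n - (b n : EReal)) ≤ ε := by
  have h := ENNReal.tendsto_ofReal ((ha.sub hb).abs)
  rw [sub_self, abs_zero, ENNReal.ofReal_zero] at h
  filter_upwards [hx, ENNReal.tendsto_nhds_zero.1 h ε hε] with n h1 h2
  rw [h1, ← EReal.coe_sub, EReal.abs_def]
  exact h2

/-! ### Uniform convergence inside and uniform divergence outside the interval. -/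

section Uniform

variable {Ω : Type*} [MeasurableSpace Ω] {P : Measure Ω} {p : (n : ℕ) → Fin n → I}
  {B : (n : ℕ) → Fin n → Ω → ℕ} (hP : ∀ n k, probSum P B n k = ENNReal.ofReal (rowCoeff p n k))
  {M : ProbabilityMeasure I} (h : EmpiricalTendsto p atTop M)
  {mlo mhi : ℝ} (h1 : (M : Measure I).real {1} = mlo) (h0 : 1 - (M : Measure I).real {0} = mhi)

theorem mul_le_of_le_div_tendsto {U : Filter ℕ} [NeBot U] (hU : U ≤ atTop) {k : ℕ → ℕ} {α c : ℝ}
    (hk : Tendsto (fun n => (k n : ℝ) / n) U (𝓝 α)) (h : ∀ᶠ n in U, c * n ≤ (k n : ℝ)) :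
    c ≤ α := by
  refine ge_of_tendsto hk ?_
  filter_upwards [h, hU (eventually_gt_atTop 0)] with n hn hn0
  rwa [le_div_iff₀ (Nat.cast_pos.2 hn0)]

theorem tendsto_le_of_div_le {U : Filter ℕ} [NeBot U] (hU : U ≤ atTop) {k : ℕ → ℕ} {α c : ℝ}
    (hk : Tendsto (fun n => (k n : ℝ) / n) U (𝓝 α)) (h : ∀ᶠ n in U, (k n : ℝ) ≤ c * n) :
    α ≤ c := by
  refine le_of_tendsto hk ?_
  filter_upwards [h, hU (eventually_gt_atTop 0)] with n hn hn0
  rwa [div_le_iff₀ (Nat.cast_pos.2 hn0)]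

theorem natCast_le_of_le_mul {c : ℝ} (hc : c ≤ 1) {n k : ℕ} (h : (k : ℝ) ≤ c * n) : k ≤ n := by
  have := mul_le_mul_of_nonneg_right hc (Nat.cast_nonneg (α := ℝ) n)
  rw [one_mul] at this
  exact_mod_cast h.trans this

include h0 in
/-- Pointwise comparison along convergent sequences implies uniform comparison inside. -/
theorem tendsto_iSup_abs_sub {x : ℕ → ℕ → EReal} {b G : ℝ → ℝ}
    (hx : ∀ (U : Ultrafilter ℕ) (k : ℕ → ℕ) (α : ℝ), (U : Filter ℕ) ≤ atTop →
      Tendsto (fun n => (k n : ℝ) / n) U (𝓝 α) → α ∈ Ioo mlo mhi → ∃ a : ℕ → ℝ,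
      (∀ᶠ n in (U : Filter ℕ), x n (k n) = (a n : EReal)) ∧ Tendsto a U (𝓝 (G α)))
    (hb : ∀ α ∈ Ioo mlo mhi, Tendsto b (𝓝 α) (𝓝 (G α))) {ε : ℝ} (hε : 0 < ε) :
    Tendsto (fun n : ℕ => ⨆ k ∈ {k : ℕ | (mlo + ε) * n ≤ (k : ℝ) ∧ (k : ℝ) ≤ (mhi - ε) * n},
      EReal.abs (x n k - (b ((k : ℝ) / n) : EReal))) atTop (𝓝 (0 : ℝ≥0∞)) := by
  have hm : mhi ≤ 1 := h0 ▸ sub_le_self _ measureReal_nonneg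
  rw [ENNReal.tendsto_nhds_zero]
  intro δ hδ
  have key := eventually_forall_of_ultrafilter
    (A := fun n k => (mlo + ε) * n ≤ (k : ℝ) ∧ (k : ℝ) ≤ (mhi - ε) * n)
    (Q := fun n k => EReal.abs (x n k - (b ((k : ℝ) / n) : EReal)) ≤ δ)
    (Eventually.of_forall fun n k hk => natCast_le_of_le_mul (by linarith) hk.2) ?_
  · filter_upwards [key] with n hn
    exact iSup₂_le hn
  · intro U k α hU hA hk
    have hα : α ∈ Ioo mlo mhi :=
      ⟨(lt_add_of_pos_right _ hε).trans_le
        (mul_le_of_le_div_tendsto hU hk (hA.mono fun n hn => hn.1)),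
      (tendsto_le_of_div_le hU hk (hA.mono fun n hn => hn.2)).trans_lt (sub_lt_self _ hε)⟩
    obtain ⟨a, ha, hlim⟩ := hx U k α hU hk hα
    exact eventually_abs_sub_le ha hlim ((hb α hα).comp hk) hδ

include hP h h1 in
theorem tendsto_iSup_logRate_left (ε : ℝ) (hε : 0 < ε) :
    Tendsto (fun n : ℕ => ⨆ k ∈ {k : ℕ | (k : ℝ) ≤ (mlo - ε) * n}, logRate P B n k)
      atTop (𝓝 (⊥ : EReal)) := by
  have hm : mlo ≤ 1 := h1 ▸ measureReal_le_one
  rw [EReal.tendsto_nhds_bot_iff_real]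
  intro x
  have key := eventually_forall_of_ultrafilter
    (A := fun n k => (k : ℝ) ≤ (mlo - ε) * n)
    -- The margin `x - 1` keeps the inequality strict after the supremum; an empty supremum is `⊥`.
    (Q := fun n k => logRate P B n k < ((x - 1 : ℝ) : EReal))
    (Eventually.of_forall fun n k hk => natCast_le_of_le_mul (by linarith) hk) ?_
  · filter_upwards [key] with n hn
    exact (iSup₂_le fun k hk => (hn k hk).le).trans_lt (EReal.coe_lt_coe (by linarith))
  · intro U k α hU hA hk
    have hα := (tendsto_le_of_div_le hU hk hA).trans_lt (sub_lt_self _ hε)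
    exact (EReal.tendsto_nhds_bot_iff_real.1 (tendsto_logRate_bot hP hU
      (fun f hf => (h f hf).mono_left hU) hk (Or.inl (h1 ▸ hα)))) _

include hP h h0 in
theorem tendsto_iSup_logRate_right (ε : ℝ) (hε : 0 < ε) :
    Tendsto (fun n : ℕ => ⨆ k ∈ {k : ℕ | (mhi + ε) * n ≤ (k : ℝ) ∧ k ≤ n}, logRate P B n k)
      atTop (𝓝 (⊥ : EReal)) := by
  rw [EReal.tendsto_nhds_bot_iff_real]
  intro x
  have key := eventually_forall_of_ultrafilter
    (A := fun n k => (mhi + ε) * n ≤ (k : ℝ) ∧ k ≤ n)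
    (Q := fun n k => logRate P B n k < ((x - 1 : ℝ) : EReal))
    (Eventually.of_forall fun n k hk => hk.2) ?_
  · filter_upwards [key] with n hn
    exact (iSup₂_le fun k hk => (hn k hk).le).trans_lt (EReal.coe_lt_coe (by linarith))
  · intro U k α hU hA hk
    have hα := (lt_add_of_pos_right mhi hε).trans_le
      (mul_le_of_le_div_tendsto hU hk (hA.mono fun n hn => hn.1))
    exact (EReal.tendsto_nhds_bot_iff_real.1 (tendsto_logRate_bot hP hU
      (fun f hf => (h f hf).mono_left hU) hk (Or.inr (h0 ▸ hα)))) _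

variable (hm : mlo < mhi)

include hP h h1 h0 hm in
theorem tendsto_iInf_ratio_left (ε : ℝ) (hε : 0 < ε) :
    Tendsto (fun n : ℕ => ⨅ k ∈ {k : ℕ | rLower p n ≤ k ∧ (k : ℝ) ≤ (mlo - ε) * n},
      probSum P B n (k + 1) / probSum P B n k) atTop (𝓝 (⊤ : ℝ≥0∞)) := by
  have hM : (M : Measure I).real {1} < 1 - (M : Measure I).real {0} := by rwa [h1, h0]
  have hm1 : mlo ≤ 1 := h1 ▸ measureReal_le_one
  rw [ENNReal.tendsto_nhds_top_iff_nnreal]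
  intro x
  have key := eventually_forall_of_ultrafilter
    (A := fun n k => rLower p n ≤ k ∧ (k : ℝ) ≤ (mlo - ε) * n)
    (Q := fun n k => ((x + 1 : ℝ≥0) : ℝ≥0∞) ≤ probSum P B n (k + 1) / probSum P B n k)
    (Eventually.of_forall fun n k hk => natCast_le_of_le_mul (by linarith) hk.2) ?_
  · filter_upwards [key] with n hn
    exact (ENNReal.coe_lt_coe.2 (lt_add_one x)).trans_le (le_iInf₂ hn)
  · intro U k α hU hA hk
    have hα := (tendsto_le_of_div_le hU hk (hA.mono fun n hn => hn.2)).trans_lt (sub_lt_self _ hε)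
    have hU' : EmpiricalTendsto p U M := fun f hf => (h f hf).mono_left hU
    have hx : 0 < ((x + 1 : ℝ≥0) : ℝ) := by positivity
    -- Every value of `Φ` exceeds `mlo > α`, so any positive `t` is admissible; `t = 1 / (x + 1)`
    -- makes the ratio larger than `x + 1`.
    have ht : 0 < ((x + 1 : ℝ≥0) : ℝ)⁻¹ := inv_pos.2 hx
    filter_upwards [hA, hU'.eventually_lt_mul hU hk ht ((h1 ▸ hα).trans (Phi_gt hM ht)),
      hU'.eventually_add_card_zero_le hU hk (h0 ▸ hα.trans hm)] with n hn hlt hz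
    have hc := (rowCoeff_pos_iff_mem p n (k n)).2 ⟨hn.1, (le_rUpper_iff p n (k n)).2 hz⟩
    have h3 := hlt.resolve_left hc.ne'
    rw [probSum_div hP hc, ← ENNReal.ofReal_coe_nnreal]
    refine ENNReal.ofReal_le_ofReal ?_
    rw [← div_eq_mul_inv, lt_div_iff₀ hx] at h3
    rw [le_div_iff₀ hc, mul_comm]
    exact h3.le

include hP h h1 h0 hm in
theorem tendsto_iInf_ratio_right (ε : ℝ) (hε : 0 < ε) :
    Tendsto (fun n : ℕ => ⨅ k ∈ {k : ℕ | (mhi + ε) * n ≤ (k : ℝ) ∧ k < rUpper p n},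
      probSum P B n k / probSum P B n (k + 1)) atTop (𝓝 (⊤ : ℝ≥0∞)) := by
  have hM : (M : Measure I).real {1} < 1 - (M : Measure I).real {0} := by rwa [h1, h0]
  rw [ENNReal.tendsto_nhds_top_iff_nnreal]
  intro x
  have key := eventually_forall_of_ultrafilter
    (A := fun n k => (mhi + ε) * n ≤ (k : ℝ) ∧ k < rUpper p n)
    (Q := fun n k => ((x + 1 : ℝ≥0) : ℝ≥0∞) ≤ probSum P B n k / probSum P B n (k + 1))
    (Eventually.of_forall fun n k hk => hk.2.le.trans (Nat.sub_le _ _)) ?_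
  · filter_upwards [key] with n hn
    exact (ENNReal.coe_lt_coe.2 (lt_add_one x)).trans_le (le_iInf₂ hn)
  · intro U k α hU hA hk
    have hα := (lt_add_of_pos_right mhi hε).trans_le
      (mul_le_of_le_div_tendsto hU hk (hA.mono fun n hn => hn.1))
    have hU' : EmpiricalTendsto p U M := fun f hf => (h f hf).mono_left hU
    have hx : 0 < ((x + 1 : ℝ≥0) : ℝ) := by positivity
    -- Here `t = x + 1`: every value of `Φ` lies below `mhi < α`. Positivity at `k + 1` follows from
    -- `k < rUpper p n` and from `α` exceeding the atom at `1`.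
    filter_upwards [hA, hU'.eventually_mul_lt hU hk hx ((Phi_lt hM hx).trans (h0 ▸ hα)),
      hU'.eventually_card_one_le hU hk (h1 ▸ hm.trans hα)] with n hn hlt hr
    have hc := (rowCoeff_pos_iff_mem p n (k n + 1)).2
      ⟨(rLower_eq p n ▸ hr).trans (Nat.le_succ _), hn.2⟩
    have h3 := hlt.resolve_left hc.ne'
    rw [probSum_div hP hc, ← ENNReal.ofReal_coe_nnreal]
    refine ENNReal.ofReal_le_ofReal ?_
    rw [le_div_iff₀ hc, mul_comm]
    exact h3.le

end Uniform

end BernoulliArray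

/-! ### Identification of the limit and assembly of the conclusions. -/

theorem mainTheorem7
    {Ω : Type*} [MeasurableSpace Ω] (P : Measure Ω) [IsProbabilityMeasure P]
    -- a triangular array of row-wise independent Bernoulli variables with parameters `p n k`
    (p : (n : ℕ) → Fin n → I)
    (B : (n : ℕ) → Fin n → Ω → ℕ)
    (hBmeas : ∀ n k, Measurable (B n k))
    (hBindep : ∀ n, iIndepFun (B n) P)
    (hBone : ∀ n k, P {ω | B n k ω = 1} = ENNReal.ofReal (p n k : ℝ))
    (hBzero : ∀ n k, P {ω | B n k ω = 0} = ENNReal.ofReal (1 - (p n k : ℝ)))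
    -- a nonempty interval in `[0,1]` and a function `g` on it with values in `(-∞,0]`
    (mlo mhi : ℝ) (hmlo : 0 ≤ mlo) (hmlt : mlo < mhi) (hmhi : mhi ≤ 1)
    (g : ℝ → ℝ) (hgnonpos : ∀ α ∈ Ioo mlo mhi, g α ≤ 0)
    (hinside : ∀ α ∈ Ioo mlo mhi,
      Tendsto (fun n : ℕ => BernoulliArray.logRate P B n ⌊α * n⌋₊) atTop (𝓝 (g α : EReal)))
    (houtside : ∀ α ∈ Ico 0 mlo ∪ Ioc mhi 1,
      Tendsto (fun n : ℕ => BernoulliArray.logRate P B n ⌊α * n⌋₊) atTop (𝓝 (⊥ : EReal))) :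
    ∃ M : ProbabilityMeasure I,
      -- weak convergence and the atoms of the limit
      Tendsto (fun n : ℕ => BernoulliArray.empiricalMeasure p n) atTop (𝓝 M.toFiniteMeasure) ∧
      (M : Measure I) {1} = ENNReal.ofReal mlo ∧
      (M : Measure I) {0} = ENNReal.ofReal (1 - mhi) ∧
      -- regularity of `g`
      ContDiffOn ℝ ((⊤ : ℕ∞) : WithTop ℕ∞) g (Ioo mlo mhi) ∧
      StrictConcaveOn ℝ (Ioo mlo mhi) g ∧
      -- uniform convergence inside the interval
      (∀ ε : ℝ, 0 < ε →
        Tendsto (fun n : ℕ =>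
          ⨆ k ∈ {k : ℕ | (mlo + ε) * n ≤ (k : ℝ) ∧ (k : ℝ) ≤ (mhi - ε) * n},
            EReal.abs (BernoulliArray.logRate P B n k - (g ((k : ℝ) / n) : EReal)))
          atTop (𝓝 (0 : ℝ≥0∞))) ∧
      -- uniform divergence outside the interval
      (∀ ε : ℝ, 0 < ε →
        Tendsto (fun n : ℕ =>
          ⨆ k ∈ {k : ℕ | (k : ℝ) ≤ (mlo - ε) * n}, BernoulliArray.logRate P B n k)
          atTop (𝓝 (⊥ : EReal)) ∧
        Tendsto (fun n : ℕ =>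
          ⨆ k ∈ {k : ℕ | (mhi + ε) * n ≤ (k : ℝ) ∧ k ≤ n}, BernoulliArray.logRate P B n k)
          atTop (𝓝 (⊥ : EReal))) ∧
      -- strict convexity of `u ↦ Ψ(e^u)`, the two expressions for `Φ`, invertibility of `Φ`
      StrictConvexOn ℝ univ (fun u : ℝ => BernoulliArray.Psi M (Real.exp u)) ∧
      (∀ t : ℝ, 0 < t → DifferentiableAt ℝ (BernoulliArray.Psi M) t ∧
        BernoulliArray.Phi M t = t * deriv (BernoulliArray.Psi M) t) ∧
      BijOn (BernoulliArray.Phi M) (Ioi 0) (Ioo mlo mhi) ∧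
      -- `-g` is the Legendre transform of `u ↦ Ψ(e^u)`
      (∀ α ∈ Ioo mlo mhi,
        IsLUB (range fun u : ℝ => α * u - BernoulliArray.Psi M (Real.exp u)) (-g α) ∧
        IsGLB (range fun u : ℝ => BernoulliArray.Psi M (Real.exp u) - u * α) (g α) ∧
        g α = BernoulliArray.Psi M (BernoulliArray.PhiInv M α)
          - α * Real.log (BernoulliArray.PhiInv M α)) ∧
      -- the derivative of `g`
      (∀ α ∈ Ioo mlo mhi, Real.exp (-deriv g α) = BernoulliArray.PhiInv M α) ∧
      StrictConcaveOn ℝ (Ioo mlo mhi) (fun α : ℝ => g α + α * Real.log α) ∧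
      Tendsto (deriv g) (𝓝[>] mlo) atTop ∧
      Tendsto (deriv g) (𝓝[<] mhi) atBot ∧
      -- the mean `p_*` of the limit measure
      (∫ y : I, (y : ℝ) ∂(M : Measure I)) = BernoulliArray.Phi M 1 ∧
      (∫ y : I, (y : ℝ) ∂(M : Measure I)) ∈ Ioo mlo mhi ∧
      g (∫ y : I, (y : ℝ) ∂(M : Measure I)) = 0 ∧
      -- uniform convergence of the quotients inside the interval
      (∀ ε : ℝ, 0 < ε →
        Tendsto (fun n : ℕ =>
          ⨆ k ∈ {k : ℕ | (mlo + ε) * n ≤ (k : ℝ) ∧ (k : ℝ) ≤ (mhi - ε) * n},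
            EReal.abs (((BernoulliArray.probSum P B n (k + 1)
                / BernoulliArray.probSum P B n k : ℝ≥0∞) : EReal)
              - (Real.exp (deriv g ((k : ℝ) / n)) : EReal)))
          atTop (𝓝 (0 : ℝ≥0∞))) ∧
      -- the support of `S_n`, and divergence of the quotients outside the interval
      (∀ n k : ℕ, BernoulliArray.probSum P B n k ≠ 0 ↔
        BernoulliArray.rLower p n ≤ k ∧ k ≤ BernoulliArray.rUpper p n) ∧
      (∀ ε : ℝ, 0 < ε →
        Tendsto (fun n : ℕ =>
          ⨅ k ∈ {k : ℕ | BernoulliArray.rLower p n ≤ k ∧ (k : ℝ) ≤ (mlo - ε) * n},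
            BernoulliArray.probSum P B n (k + 1) / BernoulliArray.probSum P B n k)
          atTop (𝓝 (⊤ : ℝ≥0∞)) ∧
        Tendsto (fun n : ℕ =>
          ⨅ k ∈ {k : ℕ | (mhi + ε) * n ≤ (k : ℝ) ∧ k < BernoulliArray.rUpper p n},
            BernoulliArray.probSum P B n k / BernoulliArray.probSum P B n (k + 1))
          atTop (𝓝 (⊤ : ℝ≥0∞))) := by
  have hP : ∀ n k, BernoulliArray.probSum P B n k =
      ENNReal.ofReal (BernoulliArray.rowCoeff p n k) := fun n k =>
    BernoulliArray.measure_sum_eq_coeff_genPoly P (B n) (hBmeas n) (hBindep n) (hBone n)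
      (hBzero n) Finset.univ k
  have hident := fun (U : Ultrafilter ℕ) (hU : (U : Filter ℕ) ≤ atTop)
      (N : ProbabilityMeasure I) (hN : BernoulliArray.EmpiricalTendsto p U N) =>
    BernoulliArray.atoms_and_rate_of_tendsto hP hmlo hmlt hinside houtside hU hN
  -- Any ultrafilter finer than `atTop` produces a candidate; the next steps show that all of them
  -- produce the same measure.
  obtain ⟨M, hU0⟩ := BernoulliArray.exists_empiricalTendsto p (hyperfilter ℕ)
    Nat.hyperfilter_le_atTop
  obtain ⟨h1, h0, hg⟩ := hident _ Nat.hyperfilter_le_atTop M hU0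
  have hM : (M : Measure I).real {1} < 1 - (M : Measure I).real {0} := by rwa [h1, h0]
  have hlim : BernoulliArray.EmpiricalTendsto p atTop M := by
    intro f hf
    rw [tendsto_iff_ultrafilter]
    intro U hU
    obtain ⟨N, hN⟩ := BernoulliArray.exists_empiricalTendsto p U hU
    obtain ⟨h1', h0', hg'⟩ := hident U hU N hN
    have hNM : N = M := BernoulliArray.eq_of_rate_eq hM (h1'.trans h1.symm) (h0'.trans h0.symm)
      fun α hα => by
        rw [h1, h0] at hα
        rw [← hg α hα, ← hg' α hα]
    exact hNM ▸ hN f hf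
  have hI : Ioo ((M : Measure I).real {1}) (1 - (M : Measure I).real {0}) = Ioo mlo mhi := by
    rw [h1, h0]
  have hpos : ∀ α ∈ Ioo mlo mhi, 0 < BernoulliArray.PhiInv M α := fun α hα =>
    BernoulliArray.PhiInv_pos hM (hI ▸ hα)
  have hderiv : ∀ α ∈ Ioo mlo mhi, HasDerivAt g (-Real.log (BernoulliArray.PhiInv M α)) α :=
    fun α hα => (BernoulliArray.hasDerivAt_rate hM (hI ▸ hα)).congr_of_eventuallyEq
      (eventually_of_mem (Ioo_mem_nhds hα.1 hα.2) hg)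
  have hexp : ∀ α ∈ Ioo mlo mhi,
      Real.exp (deriv g α) = (BernoulliArray.PhiInv M α)⁻¹ := fun α hα => by
    rw [(hderiv α hα).deriv, Real.exp_neg, Real.exp_log (hpos α hα)]
  have hmean : BernoulliArray.Phi M 1 ∈ Ioo mlo mhi :=
    hI ▸ (BernoulliArray.bijOn_Phi hM).mapsTo (mem_Ioi.2 one_pos)
  refine ⟨M, hlim.tendsto_empiricalMeasure, ?_, ?_, ?_, ?_, ?_, ?_, ?_, ?_, ?_, ?_, ?_, ?_, ?_, ?_,
    ?_, ?_, ?_, ?_, ?_, ?_⟩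
  · rw [← h1, ofReal_measureReal]
  · rw [← h0, sub_sub_cancel, ofReal_measureReal]
  · exact (hI ▸ BernoulliArray.contDiffOn_rate hM).congr hg
  · exact (hI ▸ BernoulliArray.strictConcaveOn_rate hM).congr fun α hα => (hg α hα).symm
  · intro ε hε
    refine BernoulliArray.tendsto_iSup_abs_sub h0 (G := g)
      (fun U k α hU hk hα => ?_) (fun α hα => (hderiv α hα).continuousAt) hε
    have hU' : BernoulliArray.EmpiricalTendsto p U M := fun f hf => (hlim f hf).mono_left hU
    refine ⟨fun n => Real.log (BernoulliArray.rowCoeff p n (k n)) / n, ?_, ?_⟩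
    · filter_upwards [hU'.eventually_pos hU hk (hI ▸ hα)] with n hn
      exact BernoulliArray.logRate_of_pos hP hn
    · rw [hg α hα]
      exact hU'.tendsto_log_rowCoeff hM hU hk (hI ▸ hα)
  · exact fun ε hε => ⟨BernoulliArray.tendsto_iSup_logRate_left hP hlim h1 ε hε,
      BernoulliArray.tendsto_iSup_logRate_right hP hlim h0 ε hε⟩
  · exact BernoulliArray.strictConvexOn_Psi_exp hM
  · intro t ht
    have hd := BernoulliArray.hasDerivAt_Psi M ht
    exact ⟨hd.differentiableAt, by rw [hd.deriv, BernoulliArray.Phi_eq]⟩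
  · exact hI ▸ BernoulliArray.bijOn_Phi hM
  · intro α hα
    have hp := hpos α hα
    have hle := BernoulliArray.rate_le hM (hI ▸ hα)
    rw [← hg α hα] at hle
    refine ⟨IsGreatest.isLUB ⟨⟨Real.log (BernoulliArray.PhiInv M α), ?_⟩, ?_⟩,
      IsLeast.isGLB ⟨⟨Real.log (BernoulliArray.PhiInv M α), ?_⟩, ?_⟩, hg α hα⟩
    · simp only [Real.exp_log hp, hg α hα]
      ring
    · rintro _ ⟨u, rfl⟩
      have := hle u
      simp only
      linarith
    · simp only [Real.exp_log hp, hg α hα]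
      ring
    · rintro _ ⟨u, rfl⟩
      exact hle u
  · intro α hα
    rw [(hderiv α hα).deriv, neg_neg, Real.exp_log (hpos α hα)]
  · exact (hI ▸ BernoulliArray.strictConcaveOn_rate_add hM).congr fun α hα => by
      simp only [hg α hα]
  · have := tendsto_neg_atBot_atTop.comp
      (Real.tendsto_log_nhdsGT_zero.comp (BernoulliArray.tendsto_PhiInv_left hM))
    rw [h1] at this
    refine this.congr' ?_
    filter_upwards [Ioo_mem_nhdsGT hmlt] with α hα
    exact (hderiv α hα).deriv.symm
  · have := tendsto_neg_atTop_atBot.comp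
      (Real.tendsto_log_atTop.comp (BernoulliArray.tendsto_PhiInv_right hM))
    rw [h0] at this
    refine this.congr' ?_
    filter_upwards [Ioo_mem_nhdsLT hmlt] with α hα
    exact (hderiv α hα).deriv.symm
  · exact (BernoulliArray.Phi_one M).symm
  · rwa [← BernoulliArray.Phi_one M]
  · rw [← BernoulliArray.Phi_one M, hg _ hmean, BernoulliArray.PhiInv_Phi hM (t := 1) one_pos,
      BernoulliArray.Psi_one, Real.log_one, mul_zero, sub_zero]
  · intro ε hε
    -- Here `e^{g'}` and `1/Φ←` coincide only on the open interval, so `b` and `G` are kept apart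
    -- and matched near each interior point.
    refine BernoulliArray.tendsto_iSup_abs_sub h0
      (b := fun α => Real.exp (deriv g α))
      (G := fun α => (BernoulliArray.PhiInv M α)⁻¹) (fun U k α hU hk hα => ?_) (fun α hα => ?_) hε
    · have hU' : BernoulliArray.EmpiricalTendsto p U M := fun f hf => (hlim f hf).mono_left hU
      refine ⟨fun n => BernoulliArray.rowCoeff p n (k n + 1) / BernoulliArray.rowCoeff p n (k n),
        ?_, hU'.tendsto_ratio hM hU hk (hI ▸ hα)⟩
      filter_upwards [hU'.eventually_pos hU hk (hI ▸ hα)] with n hn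
      rw [BernoulliArray.probSum_div hP hn, EReal.coe_ennreal_ofReal, max_eq_left]
      exact div_nonneg (BernoulliArray.rowCoeff_nonneg p n _) hn.le
    · refine ((BernoulliArray.continuousAt_PhiInv hM (hI ▸ hα)).inv₀
        (hpos α hα).ne').tendsto.congr' ?_
      filter_upwards [Ioo_mem_nhds hα.1 hα.2] with β hβ
      exact (hexp β hβ).symm
  · intro n k
    rw [hP, ← BernoulliArray.rowCoeff_pos_iff_mem, Ne, ENNReal.ofReal_eq_zero, not_le]
  · exact fun ε hε => ⟨BernoulliArray.tendsto_iInf_ratio_left hP hlim h1 h0 hmlt ε hε,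
      BernoulliArray.tendsto_iInf_ratio_right hP hlim h1 h0 hmlt ε hε⟩
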